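/- Let $\mathbb{K}$ be a field of characteristic zero and let $\Sigma$ be a signature, that is, a set with an arity map $\mathrm{ar} : \Sigma \to \mathbb{N}$. **The Hopf algebra $\mathbf{N}(T(\Sigma))$.** A $\Sigma$-term is either the leaf or $s(t_1, \dots, t_{\mathrm{ar}(s)})$ with $s \in \Sigma$ and $t_i$ $\Sigma$-terms. The terms form the free operad $T(\Sigma)$: for a term $y$ with $n$ leaves, $y[w_1, \dots, w_n]$ is obtained by grafting the term $w_i$ onto the $i$-th leaf of $y$, and the unit is the leaf. A reduced $\Sigma$-forest is a word of terms different from the leaf, and $\mathrm{rd}(w)$ is the word obtained from a word $w$ of terms by deleting the leaves. $\mathbf{N}(T(\Sigma))$ is the $\mathbb{K}$-vector space with basis $E_\mathfrak{f}$, $\mathfrak{f}$ a reduced $\Sigma$-forest, with product $E_\mathfrak{f} \cdot E_\mathfrak{g} = E_{\mathfrak{f}\mathfrak{g}}$ (concatenation), with counit sending $E_\mathfrak{f}$ to $1$ if $\mathfrak{f}$ is empty and to $0$ otherwise, and with the coproduct that is the algebra morphism such that, for any term $x$ different from the leaf, $$\Delta E_x = \sum_{x = y[w_1, \dots, w_n]}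 E_{\mathrm{rd}(y)} \otimes E_{\mathrm{rd}(w_1 \cdots w_n)} .$$ **The Hopf algebra $\mathbf{NCK}(\Sigma)$.** A $\Sigma$-trimmed forest is a word of nonempty planar rooted trees in which each node is decorated by some $s \in \Sigma$ and has at most $\mathrm{ar}(s)$ children. For a set $I$ of nodes of such a forest $f$, $f(I)$ is the trimmed forest obtained by keeping only the nodes of $I$ and the edges between them. $\mathbf{NCK}(\Sigma)$ is the $\mathbb{K}$-vector space with basis $E_f$, $f$ a $\Sigma$-trimmed forest, with the concatenation product, the counit sending $E_f$ to $1$ if $f$ is empty and to $0$ otherwise, and the coproduct $$\Delta E_f = \sum_{(I_1, I_2)} E_{f(I_1)} \otimes E_{f(I_2)},$$ over the pairs of disjoint sets $I_1, I_2$ whose union is the set of all nodes of $f$, such that $I_1$ contains all ancestors of its elements and $I_2$ contains all descendants of its elements. For a reduced $\Sigma$-forest $\mathfrak{f}$, let $\mathrm{tr}(\mathfrak{f})$ be the $\Sigma$-trimmed forest obtained by removing the leaves of $\mathfrak{f}$. **The map $\mathsf{r}_{A}$.** The alphabet of positions $A_{\mathrm{p}}(\Sigma)$ consists of the letters $\mathbf{a}^s_u$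 with $s \in \Sigma$ and $u$ a word on $\mathbb{N}$; the letters $\mathbf{a}^s_{0^\ell}$ are its root letters, the letters $\mathbf{a}^s_u$ are its $s$-decorated letters, and for $j \geq 1$ its $j$-edges are the pairs $(\mathbf{a}^s_u, \mathbf{a}^{s'}_{u j 0^\ell})$, for all $s, s', u, \ell$. The alphabet of lengths $A_{\mathrm{l}}(\Sigma)$ is the quotient of $A_{\mathrm{p}}(\Sigma)$ identifying $\mathbf{a}^s_u$ and $\mathbf{a}^s_v$ when $u$ and $v$ have the same length, with the image relations. For an alphabet $A$ with such relations, a word on $A$ is compatible with a reduced forest $\mathfrak{f}$ if its length is the number of internal nodes of $\mathfrak{f}$ and, when its letters are associated with the internal nodes in left to right preorder, the roots have root letters, each node decorated by $s$ has an $s$-decorated letter, and the letters of a node and of its $j$-th child form a $j$-edge. Let $\mathsf{r}_A$ be the linear map from $\mathbf{N}(T(\Sigma))$ to the space of noncommutative polynomials on $A$ (of finite degree, with possibly infinite support) sending $E_\mathfrak{f}$ to the sum of all words compatible with $\mathfrak{f}$. **Theorem.** The kernel of $\mathsf{r}_{A_{\mathrm{l}}(\Sigma)}$ is the subspace of $\mathbf{N}(T(\Sigma))$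 spanned by the differences $E_{\mathfrak{f}_1} - E_{\mathfrak{f}_2}$, where $\mathfrak{f}_1$ and $\mathfrak{f}_2$ are reduced $\Sigma$-forests with $\mathrm{tr}(\mathfrak{f}_1) = \mathrm{tr}(\mathfrak{f}_2)$. This kernel is a Hopf ideal, and there is a unique linear map $$\phi : \mathbf{N}(T(\Sigma)) / \operatorname{Ker} \mathsf{r}_{A_{\mathrm{l}}(\Sigma)} \to \mathbf{NCK}(\Sigma)$$ sending the class of $E_\mathfrak{f}$ to $E_{\mathrm{tr}(\mathfrak{f})}$ for each reduced $\Sigma$-forest $\mathfrak{f}$; this map $\phi$ is an isomorphism of Hopf algebras. -/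

import Mathlib

open scoped TensorProduct
namespace NaturalHopf

/-! ### Words with concatenation product -/

section WordAlgebra
variable (K : Type*) [Field K] (X : Type*)

/-- The `K`-linear span of the words on `X`, with the concatenation product. -/
def WordAlg : Type _ := MonoidAlgebra K (FreeMonoid X)

noncomputable instance : Ring (WordAlg K X) := inferInstanceAs (Ring (MonoidAlgebra K (FreeMonoid X)))
noncomputable instance : Algebra K (WordAlg K X) :=
  inferInstanceAs (Algebra K (MonoidAlgebra K (FreeMonoid X)))

variable {X}
/-- The basis element `E_f` indexed by the word `f`. -/
noncomputable def E (f : List X) : WordAlg K X :=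
  MonoidAlgebra.of K (FreeMonoid X) (FreeMonoid.ofList f)

variable (X) in
/-- The elementary basis. -/
noncomputable def eBasis : Module.Basis (List X) K (WordAlg K X) :=
  MonoidAlgebra.basis (FreeMonoid X) K

variable {K}

@[simp] theorem eBasis_apply (f : List X) : eBasis K X f = E K f := by
  simp only [eBasis]
  exact MonoidAlgebra.basis_apply K (FreeMonoid.ofList f)

theorem E_nil : E K ([] : List X) = 1 := map_one (MonoidAlgebra.of K (FreeMonoid X))

theorem E_append (f g : List X) : E K (f ++ g) = E K f * E K g :=
  map_mul (MonoidAlgebra.of K (FreeMonoid X)) _ _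

/-- The unital algebra morphism with prescribed values on the letters. -/
noncomputable def liftWord {B : Type*} [Ring B] [Algebra K B] (g : X → B) : WordAlg K X →ₐ[K] B :=
  MonoidAlgebra.lift K B (FreeMonoid X) (FreeMonoid.lift g)

theorem liftWord_E {B : Type*} [Ring B] [Algebra K B] (g : X → B) (f : List X) :
    liftWord g (E K f) = (f.map g).prod := by
  have : liftWord (K := K) g (E K f) = FreeMonoid.lift g (FreeMonoid.ofList f) :=
    MonoidAlgebra.lift_of _ _
  rw [this, FreeMonoid.lift_apply]; rfl

theorem word_induction {p : WordAlg K X → Prop} (hE : ∀ f, p (E K f))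
    (hadd : ∀ x y, p x → p y → p (x + y)) (hsmul : ∀ (a : K) x, p x → p (a • x))
    (x : WordAlg K X) : p x := by
  have hx : x ∈ Submodule.span K (Set.range (eBasis K X)) := by
    rw [Module.Basis.span_eq]; trivial
  refine Submodule.span_induction ?_ ?_ (fun x y _ _ => hadd x y) (fun a x _ => hsmul a x) hx
  · rintro _ ⟨f, rfl⟩
    rw [eBasis_apply]
    exact hE f
  · have := hsmul 0 _ (hE [])
    rwa [zero_smul] at this

theorem algHom_ext_word {B : Type*} [Ring B] [Algebra K B] {g h : WordAlg K X →ₐ[K] B}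
    (H : ∀ x, g (E K [x]) = h (E K [x])) : g = h := by
  apply AlgHom.toLinearMap_injective
  apply (eBasis K X).ext
  intro f
  simp only [eBasis_apply, AlgHom.toLinearMap_apply]
  induction f with
  | nil => simp [E_nil]
  | cons x f ih =>
    have : x :: f = [x] ++ f := rfl
    rw [this, E_append, map_mul, map_mul, H, ih]

end WordAlgebra

/-! ### Bialgebras and Hopf algebras from cuts (auxiliary) -/

section Cuts
variable {X : Type*}

/-- Extension of a family of cuts from letters to words. -/
def cutWord (c : X → Multiset (List X × List X)) : List X → Multiset (List X × List X)
  | [] => {([], [])}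
  | x :: f => (c x).bind fun p => (cutWord c f).map fun q => (p.1 ++ q.1, p.2 ++ q.2)

theorem cutWord_append (c : X → Multiset (List X × List X)) (f g : List X) :
    cutWord c (f ++ g) =
      (cutWord c f).bind fun p => (cutWord c g).map fun q => (p.1 ++ q.1, p.2 ++ q.2) := by
  induction f with
  | nil => simp [cutWord]
  | cons x f ih =>
    simp only [List.cons_append, cutWord, ih, Multiset.bind_assoc, Multiset.map_bind,
      Multiset.bind_map, Multiset.map_map, Function.comp_def, List.append_assoc]

theorem cutWord_singleton (c : X → Multiset (List X × List X)) (x : X) :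
    cutWord c [x] = c x := by
  simp only [cutWord, Multiset.map_singleton, List.append_nil]
  exact (Multiset.bind_singleton _ _).trans (Multiset.map_id _)

theorem sum_map_bind {α β M : Type*} [AddCommMonoid M] (m : Multiset α) (f : α → Multiset β)
    (g : β → M) : ((m.bind f).map g).sum = (m.map fun a => ((f a).map g).sum).sum := by
  rw [Multiset.map_bind, Multiset.sum_bind]

variable {K : Type*} [Field K]

/-- The sum of `E_u ⊗ E_l` over a multiset of pairs `(u, l)`. -/
noncomputable def sumE (m : Multiset (List X × List X)) : WordAlg K X ⊗[K] WordAlg K X :=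
  (m.map fun p => E K p.1 ⊗ₜ[K] E K p.2).sum

theorem sumE_mul (m n : Multiset (List X × List X)) :
    sumE (K := K) (m.bind fun p => n.map fun q => (p.1 ++ q.1, p.2 ++ q.2)) =
      sumE m * sumE n := by
  unfold sumE
  rw [sum_map_bind, ← Multiset.sum_map_mul_right]
  congr 1
  refine Multiset.map_congr rfl fun p _ => ?_
  rw [← Multiset.sum_map_mul_left, Multiset.map_map]
  congr 1
  refine Multiset.map_congr rfl fun q _ => ?_
  simp [E_append, Algebra.TensorProduct.tmul_mul_tmul]

theorem sumE_nil : sumE (K := K) {(([] : List X), ([] : List X))} = 1 := by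
  simp [sumE, E_nil, Algebra.TensorProduct.one_def]

/-- The counit: `1` on the empty word, `0` on the other words. -/
noncomputable def counitWord (K : Type*) [Field K] (X : Type*) : WordAlg K X →ₐ[K] K :=
  liftWord fun _ => 0

theorem counitWord_E (f : List X) :
    counitWord K X (E K f) = if f = [] then 1 else 0 := by
  rw [counitWord, liftWord_E]
  cases f <;> simp

theorem map_multiset_sum' {F A B ι : Type*} [AddCommMonoid A] [AddCommMonoid B] [FunLike F A B]
    [AddMonoidHomClass F A B] (g : F) (m : Multiset ι) (h : ι → A) :
    g (m.map h).sum = (m.map fun i => g (h i)).sum := by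
  rw [map_multiset_sum, Multiset.map_map]; rfl

/-- The bialgebra of a coassociative counital family of cuts. -/
@[reducible] noncomputable def bialgebraOfCuts (c : X → Multiset (List X × List X))
    (Δ : WordAlg K X →ₐ[K] WordAlg K X ⊗[K] WordAlg K X)
    (hΔ : ∀ f, Δ (E K f) = sumE (cutWord c f))
    (hassoc : ∀ x, ((c x).bind fun p => (cutWord c p.1).map fun q => (q.1, q.2, p.2)) =
      (c x).bind fun p => (cutWord c p.2).map fun q => (p.1, q.1, q.2))
    (hl : ∀ x, ((c x).bind fun p => if p.1 = [] then {p.2} else 0) = {[x]})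
    (hr : ∀ x, ((c x).bind fun p => if p.2 = [] then {p.1} else 0) = {[x]}) :
    Bialgebra K (WordAlg K X) :=
  Bialgebra.ofAlgHom Δ (counitWord K X)
    (by
      apply algHom_ext_word
      intro x
      have H := congrArg (fun m => (m.map fun p : List X × List X × List X =>
        E K p.1 ⊗ₜ[K] (E K p.2.1 ⊗ₜ[K] E K p.2.2)).sum) (hassoc x)
      simp only [sum_map_bind, Multiset.map_map, Function.comp_def] at H
      simp only [AlgHom.comp_apply, hΔ, cutWord_singleton]
      simp only [sumE, map_multiset_sum', Algebra.TensorProduct.map_tmul, hΔ, AlgHom.id_apply]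
      refine Eq.trans ?_ (H.trans ?_)
      · congr 1
        refine Multiset.map_congr rfl fun p _ => ?_
        have : ∀ z : WordAlg K X ⊗[K] WordAlg K X, ∀ y : WordAlg K X,
          z ⊗ₜ[K] y = (TensorProduct.mk K _ _).flip y z := fun _ _ => rfl
        rw [this, map_multiset_sum']
        erw [map_multiset_sum']
        rfl
      · congr 1
        refine Multiset.map_congr rfl fun p _ => ?_
        have : ∀ z : WordAlg K X ⊗[K] WordAlg K X, ∀ y : WordAlg K X,
          y ⊗ₜ[K] z = (TensorProduct.mk K _ _) y z := fun _ _ => rfl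
        rw [this, map_multiset_sum']
        rfl)
    (by
      apply algHom_ext_word
      intro x
      have H := congrArg (fun m => (m.map fun p : List X =>
        (1 : K) ⊗ₜ[K] E K p).sum) (hl x)
      simp only [sum_map_bind, Multiset.map_singleton, Multiset.sum_singleton] at H
      simp only [AlgHom.comp_apply, hΔ, cutWord_singleton]
      simp only [sumE, map_multiset_sum', Algebra.TensorProduct.map_tmul, counitWord_E,
        AlgHom.id_apply]
      refine Eq.trans ?_ (H.trans ?_)
      · congr 1
        refine Multiset.map_congr rfl fun p _ => ?_
        by_cases h : p.1 = [] <;> simp [h]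
      · simp)
    (by
      apply algHom_ext_word
      intro x
      have H := congrArg (fun m => (m.map fun p : List X =>
        E K p ⊗ₜ[K] (1 : K)).sum) (hr x)
      simp only [sum_map_bind, Multiset.map_singleton, Multiset.sum_singleton] at H
      simp only [AlgHom.comp_apply, hΔ, cutWord_singleton]
      simp only [sumE, map_multiset_sum', Algebra.TensorProduct.map_tmul, counitWord_E,
        AlgHom.id_apply]
      refine Eq.trans ?_ (H.trans ?_)
      · congr 1
        refine Multiset.map_congr rfl fun p _ => ?_
        by_cases h : p.2 = [] <;> simp [h]
      · simp)

end Cuts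

section Antipode
variable {K A ι : Type*} [Field K] [Ring A] [Bialgebra K A]
open WithConv Coalgebra

theorem conv_apply_of_comul {a : A} {m : Multiset (ι × ι)} {b : ι → A}
    (h : comul (R := K) a = (m.map fun p => b p.1 ⊗ₜ[K] b p.2).sum)
    (f g : WithConv (A →ₗ[K] A)) :
    (f * g) a = (m.map fun p => f (b p.1) * g (b p.2)).sum := by
  rw [LinearMap.convMul_apply, h, map_multiset_sum', map_multiset_sum']
  rfl

/-- A bialgebra with a basis graded by natural numbers, whose coproduct respects the degree and
whose elements of degree zero are scalars, is a Hopf algebra. -/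
@[reducible] noncomputable def hopfOfGraded (b : Module.Basis ι K A) (d : ι → ℕ)
    (h0 : ∀ i, d i = 0 → b i = algebraMap K A (counit (b i)))
    (hΔ : ∀ i, ∃ m : Multiset (ι × ι),
      comul (R := K) (b i) = (m.map fun p => b p.1 ⊗ₜ[K] b p.2).sum ∧
        ∀ p ∈ m, d p.1 + d p.2 ≤ d i) : HopfAlgebra K A :=
  let x : WithConv (A →ₗ[K] A) := 1 - toConv LinearMap.id
  let T : ℕ → WithConv (A →ₗ[K] A) := fun n => ∑ k ∈ Finset.range n, x ^ k
  let S : A →ₗ[K] A := b.constr K fun i => T (d i + 1) (b i)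
  have hx0 : ∀ i, d i = 0 → x (b i) = 0 := fun i hi => by
    change algebraMap K A (counit (b i)) - b i = 0
    rw [← h0 i hi, sub_self]
  have hxn : ∀ n i, d i < n → (x ^ n) (b i) = 0 := by
    intro n
    induction n with
    | zero => intro i hi; omega
    | succ n ih =>
      intro i hi
      obtain ⟨m, hm, hd⟩ := hΔ i
      rw [pow_succ', conv_apply_of_comul hm]
      apply Multiset.sum_eq_zero
      intro y hy
      obtain ⟨p, hp, rfl⟩ := Multiset.mem_map.1 hy
      have := hd p hp
      by_cases h : d p.1 = 0
      · rw [hx0 _ h, zero_mul]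
      · rw [ih p.2 (by omega), mul_zero]
  have hT : ∀ n i, d i < n → T n (b i) = S (b i) := by
    intro n i hi
    have hS : S (b i) = T (d i + 1) (b i) := by simp [S]
    rw [hS]
    induction n, hi using Nat.le_induction with
    | base => rfl
    | succ n hn ih =>
      rw [← ih]
      change (∑ k ∈ Finset.range (n + 1), x ^ k) (b i) = _
      rw [Finset.sum_range_succ]
      change (T n) (b i) + (x ^ n) (b i) = _
      rw [hxn n i hn, add_zero]
  have hid : toConv LinearMap.id = 1 - x := by simp [x]
  HopfAlgebra.ofConvInverse S
    (by
      apply ofConv_injective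
      apply b.ext
      intro i
      obtain ⟨m, hm, hd⟩ := hΔ i
      change (toConv S * toConv LinearMap.id : WithConv (A →ₗ[K] A)) (b i) = (1 : WithConv (A →ₗ[K] A)) (b i)
      have h1 : (T (d i + 1) * toConv LinearMap.id : WithConv (A →ₗ[K] A)) (b i) = (1 : WithConv (A →ₗ[K] A)) (b i) := by
        rw [hid, geom_sum_mul_neg]
        change (1 : WithConv (A →ₗ[K] A)) (b i) - (x ^ (d i + 1)) (b i) = _
        rw [hxn _ _ (Nat.lt_succ_self _), sub_zero]
      rw [← h1, conv_apply_of_comul hm, conv_apply_of_comul hm]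
      congr 1
      refine Multiset.map_congr rfl fun p hp => ?_
      have := hd p hp
      rw [hT (d i + 1) p.1 (by omega)])
    (by
      apply ofConv_injective
      apply b.ext
      intro i
      obtain ⟨m, hm, hd⟩ := hΔ i
      change (toConv LinearMap.id * toConv S : WithConv (A →ₗ[K] A)) (b i) = (1 : WithConv (A →ₗ[K] A)) (b i)
      have h1 : (toConv LinearMap.id * T (d i + 1) : WithConv (A →ₗ[K] A)) (b i) = (1 : WithConv (A →ₗ[K] A)) (b i) := by
        rw [hid, mul_neg_geom_sum]
        change (1 : WithConv (A →ₗ[K] A)) (b i) - (x ^ (d i + 1)) (b i) = _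
        rw [hxn _ _ (Nat.lt_succ_self _), sub_zero]
      rw [← h1, conv_apply_of_comul hm, conv_apply_of_comul hm]
      congr 1
      refine Multiset.map_congr rfl fun p hp => ?_
      have := hd p hp
      rw [hT (d i + 1) p.2 (by omega)])

end Antipode

section CutSystem

/-- Simultaneous choice of cuts for a finite sequence: the upper parts form a sequence and
the lower parts are concatenated. -/
def cutSeq {T X : Type*} : (n : ℕ) → (Fin n → Multiset (T × List X)) →
    Multiset ((Fin n → T) × List X)
  | 0, _ => {(Fin.elim0, [])}
  | n + 1, m => (m 0).bind fun p =>
      (cutSeq n fun i => m i.succ).map fun q => (Fin.cons p.1 q.1, p.2 ++ q.2)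

/-- Auxiliary: trees over `X` (with an empty tree) together with their cuts, described by
the recursion over the children of the root. -/
structure CutSystem (T X : Type*) where
  leaf : T
  inc : X → T
  toWord : T → List X
  cuts : T → Multiset (T × List X)
  deg : T → ℕ
  toWord_leaf : toWord leaf = []
  toWord_inc : ∀ x, toWord (inc x) = [x]
  cuts_leaf : cuts leaf = {(leaf, [])}
  deg_leaf : deg leaf = 0
  ind : ∀ P : T → Prop, P leaf →
    (∀ (n : ℕ) (mk : (Fin n → T) → X),
      (∀ us, cuts (inc (mk us)) = (leaf, [mk us]) ::ₘ
        (cutSeq n fun i => cuts (us i)).map fun p => (inc (mk p.1), p.2)) →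
      (∀ us, deg (inc (mk us)) = 1 + ∑ i, deg (us i)) →
      ∀ ts, (∀ i, P (ts i)) → P (inc (mk ts))) → ∀ t, P t

namespace CutSystem
variable {T X : Type*} (C : CutSystem T X)

/-- The cuts of a letter, as pairs of words. -/
def letterCuts (x : X) : Multiset (List X × List X) :=
  (C.cuts (C.inc x)).map fun p => (C.toWord p.1, p.2)

theorem eq_leaf_or_inc (t : T) : t = C.leaf ∨ ∃ x, t = C.inc x :=
  C.ind (fun t => t = C.leaf ∨ ∃ x, t = C.inc x) (Or.inl rfl)
    (fun _ _ _ _ _ _ => Or.inr ⟨_, rfl⟩) t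

theorem cutWord_toWord (t : T) : cutWord C.letterCuts (C.toWord t) =
    (C.cuts t).map fun p => (C.toWord p.1, p.2) := by
  rcases C.eq_leaf_or_inc t with rfl | ⟨x, rfl⟩
  · simp [C.toWord_leaf, C.cuts_leaf, cutWord]
  · rw [C.toWord_inc, cutWord_singleton]; rfl

theorem seq_coassoc {n : ℕ} (ts : Fin n → T)
    (h : ∀ i, ((C.cuts (ts i)).bind fun p => (C.cuts p.1).map fun q => (q.1, q.2, p.2)) =
      (C.cuts (ts i)).bind fun p => (cutWord C.letterCuts p.2).map fun q => (p.1, q.1, q.2)) :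
    ((cutSeq n fun i => C.cuts (ts i)).bind fun p =>
        (cutSeq n fun i => C.cuts (p.1 i)).map fun q => (q.1, q.2, p.2)) =
      (cutSeq n fun i => C.cuts (ts i)).bind fun p =>
        (cutWord C.letterCuts p.2).map fun q => (p.1, q.1, q.2) := by
  induction n with
  | zero => simp [cutSeq, cutWord]
  | succ n ih =>
    have ih' := ih (fun i => ts i.succ) (fun i => h i.succ)
    have h0 := h 0
    simp only [cutSeq, Multiset.bind_assoc, Multiset.bind_map, Multiset.map_bind,
      Multiset.map_map, Function.comp_def, Fin.cons_zero, Fin.cons_succ, cutWord_append]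
    have e1 := congrArg (fun m => m.bind fun r : T × List X × List X =>
      ((cutSeq n fun i => C.cuts (ts i.succ)).bind fun p =>
        (cutSeq n fun i => C.cuts (p.1 i)).map fun q =>
          ((Fin.cons r.1 q.1 : Fin (n + 1) → T), r.2.1 ++ q.2, r.2.2 ++ p.2))) h0
    simp only [Multiset.bind_assoc, Multiset.bind_map] at e1
    have e2 : ∀ r : T × List X × List X,
      ((cutSeq n fun i => C.cuts (ts i.succ)).bind fun p =>
        (cutSeq n fun i => C.cuts (p.1 i)).map fun q =>
          ((Fin.cons r.1 q.1 : Fin (n + 1) → T), r.2.1 ++ q.2, r.2.2 ++ p.2)) =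
      ((cutSeq n fun i => C.cuts (ts i.succ)).bind fun p =>
        (cutWord C.letterCuts p.2).map fun q =>
          ((Fin.cons r.1 p.1 : Fin (n + 1) → T), r.2.1 ++ q.1, r.2.2 ++ q.2)) := fun r => by
      have := congrArg (fun m => m.map fun s : (Fin n → T) × List X × List X =>
        ((Fin.cons r.1 s.1 : Fin (n + 1) → T), r.2.1 ++ s.2.1, r.2.2 ++ s.2.2)) ih'
      simpa only [Multiset.map_bind, Multiset.map_map, Function.comp_def] using this
    refine (Multiset.bind_congr fun p _ => Multiset.bind_bind _ _).trans (e1.trans ?_)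
    refine Multiset.bind_congr fun p _ => ?_
    refine (Multiset.bind_congr fun q _ => e2 (p.1, q.1, q.2)).trans ?_
    exact Multiset.bind_bind _ _

theorem coassoc_tree (t : T) :
    ((C.cuts t).bind fun p => (C.cuts p.1).map fun q => (q.1, q.2, p.2)) =
      (C.cuts t).bind fun p => (cutWord C.letterCuts p.2).map fun q => (p.1, q.1, q.2) := by
  revert t
  refine C.ind _ ?_ ?_
  · simp [C.cuts_leaf, cutWord]
  · intro n mk hmk _ ts ih
    have e := congrArg (fun m => m.map fun r : (Fin n → T) × List X × List X =>
      (C.inc (mk r.1), r.2.1, r.2.2)) (C.seq_coassoc ts ih)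
    simp only [Multiset.map_bind, Multiset.map_map, Function.comp_def] at e
    have e0 : (cutWord C.letterCuts [mk ts]).map (fun q => (C.leaf, q.1, q.2)) =
      (C.cuts (C.inc (mk ts))).map fun p => (C.leaf, C.toWord p.1, p.2) := by
      rw [cutWord_singleton]; simp [letterCuts, Multiset.map_map]
    rw [hmk ts]
    simp only [Multiset.cons_bind, Multiset.bind_map, C.cuts_leaf, Multiset.map_singleton]
    rw [e0, hmk ts, ← e]
    simp only [hmk, Multiset.map_cons, Multiset.map_map, Function.comp_def, C.toWord_leaf,
      C.toWord_inc]
    rw [Multiset.bind_cons, Multiset.cons_add, Multiset.singleton_add]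

theorem coassoc_letter (x : X) :
    ((C.letterCuts x).bind fun p => (cutWord C.letterCuts p.1).map fun q => (q.1, q.2, p.2)) =
      (C.letterCuts x).bind fun p => (cutWord C.letterCuts p.2).map fun q => (p.1, q.1, q.2) := by
  have := congrArg (fun m => m.map fun r : T × List X × List X =>
    (C.toWord r.1, r.2.1, r.2.2)) (C.coassoc_tree (C.inc x))
  simp only [Multiset.map_bind, Multiset.map_map, Function.comp_def] at this
  simp only [letterCuts, Multiset.bind_map]
  refine Eq.trans ?_ this
  refine Multiset.bind_congr fun p _ => ?_
  erw [C.cutWord_toWord]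
  simp only [Multiset.map_map, Function.comp_def]

theorem counit_left (x : X) :
    ((C.letterCuts x).bind fun p => if p.1 = [] then {p.2} else 0) = {[x]} := by
  have key : ∀ t, (∀ x, t = C.inc x →
      ((C.letterCuts x).bind fun p => if p.1 = [] then {p.2} else 0) = {[x]}) := by
    refine C.ind _ ?_ ?_
    · intro x hx
      have := C.toWord_inc x
      rw [← hx, C.toWord_leaf] at this
      simp at this
    · intro n mk hmk _ ts _ x hx
      have := C.toWord_inc x
      rw [← hx, C.toWord_inc] at this
      obtain rfl : mk ts = x := by simpa using this
      simp [letterCuts, hmk, Multiset.bind_map, C.toWord_leaf, C.toWord_inc]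
  exact key _ x rfl

theorem seq_counit_right {n : ℕ} (ts : Fin n → T)
    (h : ∀ i, ((C.cuts (ts i)).bind fun p => if p.2 = [] then {p.1} else 0) = {ts i}) :
    ((cutSeq n fun i => C.cuts (ts i)).bind fun p => if p.2 = [] then {p.1} else 0) = {ts} := by
  induction n with
  | zero => simp [cutSeq]; exact funext fun i => i.elim0
  | succ n ih =>
    have ih' := ih (fun i => ts i.succ) (fun i => h i.succ)
    simp only [cutSeq, Multiset.bind_assoc, Multiset.bind_map]
    have e : ∀ p : T × List X, ((cutSeq n fun i => C.cuts (ts i.succ)).bind fun a =>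
        if p.2 ++ a.2 = [] then ({Fin.cons p.1 a.1} : Multiset (Fin (n + 1) → T)) else 0) =
        (if p.2 = [] then {p.1} else 0 : Multiset T).bind fun u =>
          {(Fin.cons u fun i => ts i.succ : Fin (n + 1) → T)} := by
      intro p
      by_cases hp : p.2 = []
      · simp only [hp, List.nil_append, if_true, Multiset.singleton_bind]
        have := congrArg (fun m => m.map fun s : Fin n → T =>
          (Fin.cons p.1 s : Fin (n + 1) → T)) ih'
        simp only [Multiset.map_bind, Multiset.map_singleton] at this
        rw [← this]
        refine Multiset.bind_congr fun a _ => ?_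
        split_ifs <;> simp
      · simp [hp]
    simp only [e]
    rw [← Multiset.bind_assoc, h 0, Multiset.singleton_bind]
    congr 1
    exact Fin.cons_self_tail ts

theorem counit_right_tree (t : T) :
    ((C.cuts t).bind fun p => if p.2 = [] then {p.1} else 0) = {t} := by
  revert t
  refine C.ind _ ?_ ?_
  · simp [C.cuts_leaf]
  · intro n mk hmk _ ts ih
    have := congrArg (fun m => m.map fun s : Fin n → T => C.inc (mk s)) (C.seq_counit_right ts ih)
    simp only [Multiset.map_bind, Multiset.map_singleton] at this
    rw [hmk]
    simp only [Multiset.cons_bind, Multiset.bind_map, List.cons_ne_nil, if_false, zero_add]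
    rw [← this]
    refine Multiset.bind_congr fun a _ => ?_
    split_ifs <;> simp

theorem counit_right (x : X) :
    ((C.letterCuts x).bind fun p => if p.2 = [] then {p.1} else 0) = {[x]} := by
  have := congrArg (fun m => m.map C.toWord) (C.counit_right_tree (C.inc x))
  simp only [Multiset.map_bind, Multiset.map_singleton, C.toWord_inc] at this
  rw [← this, letterCuts, Multiset.bind_map]
  refine Multiset.bind_congr fun a _ => ?_
  simp only
  split_ifs <;> simp

/-- The degree of a word. -/
def wordDeg (f : List X) : ℕ := (f.map fun x => C.deg (C.inc x)).sum

theorem seq_deg {n : ℕ} (ts : Fin n → T)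
    (h : ∀ i, ∀ p ∈ C.cuts (ts i), C.deg p.1 + C.wordDeg p.2 = C.deg (ts i)) :
    ∀ p ∈ cutSeq n fun i => C.cuts (ts i),
      (∑ i, C.deg (p.1 i)) + C.wordDeg p.2 = ∑ i, C.deg (ts i) := by
  induction n with
  | zero => simp [cutSeq, wordDeg]
  | succ n ih =>
    have ih' := ih (fun i => ts i.succ) (fun i => h i.succ)
    intro p hp
    simp only [cutSeq, Multiset.mem_bind, Multiset.mem_map] at hp
    obtain ⟨a, ha, q, hq, rfl⟩ := hp
    have h1 := h 0 a ha
    have h2 := ih' q hq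
    simp only [Fin.sum_univ_succ, Fin.cons_zero, Fin.cons_succ, wordDeg, List.map_append,
      List.sum_append] at *
    omega

theorem deg_tree (t : T) : ∀ p ∈ C.cuts t, C.deg p.1 + C.wordDeg p.2 = C.deg t := by
  revert t
  refine C.ind _ ?_ ?_
  · simp [C.cuts_leaf, wordDeg]
  · intro n mk hmk hdeg ts ih p hp
    rw [hmk, Multiset.mem_cons, Multiset.mem_map] at hp
    rcases hp with rfl | ⟨q, hq, rfl⟩
    · simp [wordDeg, C.deg_leaf]
    · have := C.seq_deg ts ih q hq
      simp only [hdeg]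
      omega

theorem wordDeg_toWord (t : T) : C.wordDeg (C.toWord t) = C.deg t := by
  rcases C.eq_leaf_or_inc t with rfl | ⟨x, rfl⟩
  · simp [C.toWord_leaf, C.deg_leaf, wordDeg]
  · simp [C.toWord_inc, wordDeg]

theorem deg_word (f : List X) :
    ∀ p ∈ cutWord C.letterCuts f, C.wordDeg p.1 + C.wordDeg p.2 = C.wordDeg f := by
  induction f with
  | nil => simp [cutWord, wordDeg]
  | cons x f ih =>
    intro p hp
    simp only [cutWord, Multiset.mem_bind, Multiset.mem_map, letterCuts] at hp
    obtain ⟨a, ⟨b, hb, rfl⟩, q, hq, rfl⟩ := hp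
    have h1 := C.deg_tree _ b hb
    have h2 := ih q hq
    have h3 := C.wordDeg_toWord b.1
    simp only [wordDeg, List.map_append, List.sum_append, List.map_cons, List.sum_cons] at *
    omega

theorem deg_inc_pos (x : X) : 0 < C.deg (C.inc x) := by
  have key : ∀ t, t = C.leaf ∨ 0 < C.deg t := fun t =>
    C.ind (fun t => t = C.leaf ∨ 0 < C.deg t) (Or.inl rfl)
      (fun _ _ _ hd _ _ => Or.inr (by rw [hd]; omega)) t
  rcases key (C.inc x) with h | h
  · have := C.toWord_inc x
    rw [h, C.toWord_leaf] at this
    simp at this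
  · exact h

variable {K : Type*} [Field K]

/-- The Hopf algebra of a system of cuts. -/
@[reducible] noncomputable def hopf (Δ : WordAlg K X →ₐ[K] WordAlg K X ⊗[K] WordAlg K X)
    (hΔ : ∀ f, Δ (E K f) = sumE (cutWord C.letterCuts f)) : HopfAlgebra K (WordAlg K X) :=
  letI := bialgebraOfCuts C.letterCuts Δ hΔ C.coassoc_letter C.counit_left C.counit_right
  hopfOfGraded (eBasis K X) C.wordDeg
    (by
      intro f hf
      have : f = [] := by
        cases f with
        | nil => rfl
        | cons x f =>
          have := C.deg_inc_pos x
          simp [wordDeg] at hf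
          omega
      subst this
      rw [eBasis_apply, E_nil, Bialgebra.counit_one, map_one])
    (by
      intro f
      refine ⟨cutWord C.letterCuts f, ?_, fun p hp => (C.deg_word f p hp).le⟩
      simp only [eBasis_apply]
      exact hΔ f)

end CutSystem
end CutSystem

/-! ### Terms, the free operad and its natural Hopf algebra -/

section Terms
variable {S : Type*} (ar : S → ℕ)

/-- Terms on the signature `S` with arity map `ar`: a leaf, or a symbol `s` applied to a
sequence of `ar s` terms. -/
inductive STerm : Type _
  | leaf : STerm
  | node (s : S) (ts : Fin (ar s) → STerm) : STerm

variable {ar}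

namespace STerm

/-- The number of internal nodes. -/
def deg : STerm ar → ℕ
  | leaf => 0
  | node _ ts => 1 + ∑ i, (ts i).deg

/-- The number of leaves. -/
def arity : STerm ar → ℕ
  | leaf => 1
  | node _ ts => ∑ i, (ts i).arity

/-- The full composition `t[w_1, …, w_n]` of the free operad: the term `w_i` is grafted onto the
`i`-th leaf of `t`, the leaves being numbered from left to right. -/
def graft : (t : STerm ar) → (Fin t.arity → STerm ar) → STerm ar
  | leaf, w => w (0 : Fin 1)
  | node s ts, w => node s fun i => (ts i).graft fun j => w (finSigmaFinEquiv ⟨i, j⟩)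

end STerm

variable (ar) in
/-- Terms different from the leaf (the unit of the free operad). Reduced forests are the words
on this alphabet, that is, the elements of `List (NTerm ar)`. -/
abbrev NTerm := {t : STerm ar // t ≠ STerm.leaf}

open Classical in
/-- The reduced forest obtained from a forest by deleting the leaves among its terms. -/
noncomputable def rd (f : List (STerm ar)) : List (NTerm ar) :=
  f.filterMap fun t => if h : t = STerm.leaf then none else some ⟨t, h⟩

theorem rd_append (f g : List (STerm ar)) : rd (f ++ g) = rd f ++ rd g :=
  List.filterMap_append

theorem rd_flatten (f : List (List (STerm ar))) : rd f.flatten = (f.map rd).flatten := by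
  induction f with
  | nil => rfl
  | cons a f ih => rw [List.flatten_cons, rd_append, ih]; rfl

theorem rd_leaf : rd [(STerm.leaf : STerm ar)] = [] := by simp [rd]

theorem rd_node (s : S) (ts : Fin (ar s) → STerm ar) :
    rd [STerm.node s ts] = [⟨STerm.node s ts, by simp⟩] := by simp [rd]

theorem rd_val (x : NTerm ar) : rd [x.1] = [x] := by simp [rd, x.2]

variable (ar) in
/-- The underlying algebra of the natural Hopf algebra of the free operad: the span of the reduced
forests, with the concatenation product. -/
abbrev NatFree (K : Type*) [Field K] : Type _ := WordAlg K (NTerm ar)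

/-- The factorizations `x = y[w_1, …, w_n]` in the free operad. -/
def Factorization (x : STerm ar) : Type _ :=
  {p : Σ y : STerm ar, (Fin y.arity → STerm ar) // p.1.graft p.2 = x}

variable (K : Type*) [Field K]

/-- The coproduct on a generator:
`Δ E_x = ∑_{x = y[w_1, …, w_n]} E_{rd y} ⊗ E_{rd (w_1 … w_n)}` (a finite sum). -/
noncomputable def coprodTerm (x : STerm ar) : NatFree ar K ⊗[K] NatFree ar K :=
  ∑ᶠ p : Factorization x, E K (rd [p.1.1]) ⊗ₜ[K] E K (rd (List.ofFn p.1.2))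

variable (ar) in
/-- The coproduct: the algebra morphism extending `coprodTerm`. -/
noncomputable def natCoprod : NatFree ar K →ₐ[K] NatFree ar K ⊗[K] NatFree ar K :=
  liftWord fun x => coprodTerm K x.1

/-! Auxiliary: recursive description of the factorizations. -/

/-- The factorizations of a term with root are the trivial one and the ones obtained from
factorizations of the children of the root. -/
def Factorization.build (s : S) (ts : Fin (ar s) → STerm ar) :
    Option (∀ i, Factorization (ts i)) → Factorization (STerm.node s ts)
  | none => ⟨⟨STerm.leaf, fun _ => STerm.node s ts⟩, rfl⟩
  | some c => ⟨⟨STerm.node s fun i => (c i).1.1, fun k =>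
      (c (finSigmaFinEquiv.symm k).1).1.2 (finSigmaFinEquiv.symm k).2⟩, by
        simp only [STerm.graft]
        congr 1
        funext i
        refine Eq.trans ?_ (c i).2
        congr 1
        funext j
        rw [Equiv.symm_apply_apply]⟩

theorem Factorization.build_bijective (s : S) (ts : Fin (ar s) → STerm ar) :
    Function.Bijective (Factorization.build s ts) := by
  constructor
  · intro c d h
    cases c with
    | none =>
      cases d with
      | none => rfl
      | some d =>
        have := congrArg (fun p => p.1.1) h
        simp [build] at this
    | some c =>
      cases d with
      | none =>
        have := congrArg (fun p => p.1.1) h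
        simp [build] at this
      | some d =>
        obtain ⟨y, w, hw, rfl⟩ : ∃ (y : Fin (ar s) → STerm ar) (w : ∀ i, Fin (y i).arity → STerm ar)
            (hw : ∀ i, (y i).graft (w i) = ts i), c = fun i => ⟨⟨y i, w i⟩, hw i⟩ :=
          ⟨fun i => (c i).1.1, fun i => (c i).1.2, fun i => (c i).2, rfl⟩
        obtain ⟨z, v, hv, rfl⟩ : ∃ (y : Fin (ar s) → STerm ar) (w : ∀ i, Fin (y i).arity → STerm ar)
            (hw : ∀ i, (y i).graft (w i) = ts i), d = fun i => ⟨⟨y i, w i⟩, hw i⟩ :=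
          ⟨fun i => (d i).1.1, fun i => (d i).1.2, fun i => (d i).2, rfl⟩
        have h' := congrArg Subtype.val h
        simp only [build, Sigma.mk.injEq, STerm.node.injEq, heq_eq_eq, true_and] at h'
        obtain ⟨h1, h2⟩ := h'
        obtain rfl : y = z := h1
        have h3 := eq_of_heq h2
        congr 1
        funext i
        congr 2
        funext j
        have hh : ∀ p : (Σ i, Fin (y i).arity), p = ⟨i, j⟩ →
            w p.1 p.2 = v p.1 p.2 → w i j = v i j := by
          rintro _ rfl h
          exact h
        exact hh _ (Equiv.symm_apply_apply _ _) (congrFun h3 (finSigmaFinEquiv ⟨i, j⟩))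
  · rintro ⟨⟨y, w⟩, h⟩
    cases y with
    | leaf =>
      refine ⟨none, Subtype.ext ?_⟩
      simp only [build]
      congr 1
      funext i
      rw [show i = (0 : Fin 1) from Subsingleton.elim (α := Fin 1) i 0]
      exact h.symm
    | node s' ys =>
      simp only [STerm.graft, STerm.node.injEq] at h
      obtain ⟨rfl, h⟩ := h
      obtain rfl := eq_of_heq h
      refine ⟨some fun i => ⟨⟨ys i, fun j => w (finSigmaFinEquiv ⟨i, j⟩)⟩, rfl⟩, Subtype.ext ?_⟩
      simp only [build]
      congr 1
      funext k
      exact congrArg w (Equiv.apply_symm_apply finSigmaFinEquiv k)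

/-- Recursive description of factorizations, as an equivalence. -/
noncomputable def Factorization.equiv (s : S) (ts : Fin (ar s) → STerm ar) :
    Option (∀ i, Factorization (ts i)) ≃ Factorization (STerm.node s ts) :=
  Equiv.ofBijective _ (Factorization.build_bijective s ts)

instance Factorization.uniqueLeaf : Unique (Factorization (STerm.leaf : STerm ar)) where
  default := ⟨⟨STerm.leaf, fun _ => STerm.leaf⟩, rfl⟩
  uniq := by
    rintro ⟨⟨y, w⟩, h⟩
    cases y with
    | leaf =>
      refine Subtype.ext ?_
      change (⟨STerm.leaf, w⟩ : Σ y : STerm ar, (Fin y.arity → STerm ar)) = ⟨STerm.leaf, _⟩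
      congr 1
      funext i
      rw [show i = (0 : Fin 1) from Subsingleton.elim (α := Fin 1) i 0]
      exact h
    | node s' ys => simp [STerm.graft] at h

theorem Factorization.finite (x : STerm ar) : Finite (Factorization x) := by
  induction x with
  | leaf => infer_instance
  | node s ts ih => exact Finite.of_equiv _ (Factorization.equiv s ts)

noncomputable instance (x : STerm ar) : Fintype (Factorization x) :=
  haveI := Factorization.finite x
  Fintype.ofFinite _

/-- The multiset of pairs `(y, rd w)` for `x = y[w]`. -/
noncomputable def termCuts (x : STerm ar) : Multiset (STerm ar × List (NTerm ar)) :=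
  (Finset.univ : Finset (Factorization x)).val.map fun c => (c.1.1, rd (List.ofFn c.1.2))

theorem univ_map_equiv {α β γ : Type*} [Fintype α] [Fintype β] (e : α ≃ β) (f : β → γ) :
    (Finset.univ : Finset β).val.map f = (Finset.univ : Finset α).val.map fun a => f (e a) := by
  rw [← Finset.map_univ_equiv e, Finset.map_val, Multiset.map_map]; rfl

theorem univ_map_option {α γ : Type*} [Fintype α] (f : Option α → γ) :
    (Finset.univ : Finset (Option α)).val.map f =
      f none ::ₘ (Finset.univ : Finset α).val.map fun a => f (some a) := by
  rw [univ_option, Finset.insertNone]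
  simp

theorem univ_map_prod {α β γ : Type*} [Fintype α] [Fintype β] (f : α × β → γ) :
    (Finset.univ : Finset (α × β)).val.map f =
      (Finset.univ : Finset α).val.bind fun a =>
        (Finset.univ : Finset β).val.map fun b => f (a, b) := by
  rw [← Finset.univ_product_univ, Finset.product_val]
  simp [SProd.sprod, Multiset.product, Multiset.map_bind]

theorem cutSeq_univ {T Y : Type*} {n : ℕ} (α : Fin n → Type*) [∀ i, Fintype (α i)]
    [Fintype (∀ i, α i)] (F : ∀ i, α i → T × List Y) :
    (cutSeq n fun i => (Finset.univ : Finset (α i)).val.map (F i)) =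
      (Finset.univ : Finset (∀ i, α i)).val.map fun c =>
        (fun i => (F i (c i)).1, (List.ofFn fun i => (F i (c i)).2).flatten) := by
  induction n with
  | zero =>
    have : (Finset.univ : Finset (∀ i, α i)) = {fun i => i.elim0} := by
      ext c
      simp only [Finset.mem_univ, Finset.mem_singleton, true_iff]
      exact funext fun i => i.elim0
    rw [this]
    simp only [cutSeq, Finset.singleton_val, Multiset.map_singleton]
    congr 2
    exact funext fun i => i.elim0
  | succ n ih =>
    classical
    rw [univ_map_equiv (Fin.consEquiv α), univ_map_prod]
    simp only [cutSeq, ih (fun i => α i.succ) (fun i => F i.succ), Multiset.bind_map,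
      Multiset.map_map, Function.comp_def]
    refine Multiset.bind_congr fun a _ => Multiset.map_congr rfl fun b _ => ?_
    simp only [Fin.consEquiv, Equiv.coe_fn_mk, List.ofFn_succ, List.flatten_cons, Fin.cons_zero,
      Fin.cons_succ, Prod.mk.injEq, and_true]
    funext i
    cases i using Fin.cases <;> rfl

theorem ofFn_finSigma_aux {α : Type*} {n : ℕ} {m : Fin n → ℕ} (w : (Σ i, Fin (m i)) → α)
    (u : Fin (∑ i, m i) → α) (h : ∀ p, u (finSigmaFinEquiv p) = w p) :
    List.ofFn u = (List.ofFn fun i => List.ofFn fun j => w ⟨i, j⟩).flatten := by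
  induction n with
  | zero => simp
  | succ n ih =>
    have hs := Fin.sum_univ_castSucc m
    rw [List.ofFn_congr hs u, List.ofFn_add, List.ofFn_succ', List.concat_eq_append,
      List.flatten_append, List.flatten_singleton]
    congr 1
    · apply ih (m := fun i => m i.castSucc) (fun p => w ⟨p.1.castSucc, p.2⟩)
      rintro ⟨i, j⟩
      rw [← h]
      congr 1
      apply Fin.ext
      simp [finSigmaFinEquiv_apply]
    · congr 1
      funext j
      rw [← h]
      congr 1
      apply Fin.ext
      simp [finSigmaFinEquiv_apply]
      rfl

theorem ofFn_finSigma {α : Type*} {n : ℕ} {m : Fin n → ℕ} (w : (Σ i, Fin (m i)) → α) :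
    (List.ofFn fun k => w (finSigmaFinEquiv.symm k)) =
      (List.ofFn fun i => List.ofFn fun j => w ⟨i, j⟩).flatten :=
  ofFn_finSigma_aux w _ fun p => by rw [Equiv.symm_apply_apply]

theorem termCuts_leaf : termCuts (STerm.leaf : STerm ar) = {(STerm.leaf, [])} := by
  have : (Finset.univ : Finset (Factorization (STerm.leaf : STerm ar))) = {default} := by
    ext c
    simp [Unique.eq_default c]
  unfold termCuts
  rw [this]
  simp only [Finset.singleton_val, Multiset.map_singleton]
  congr 2
  exact rd_leaf

theorem termCuts_node (s : S) (ts : Fin (ar s) → STerm ar) :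
    termCuts (STerm.node s ts) = (STerm.leaf, [⟨STerm.node s ts, by simp⟩]) ::ₘ
      (cutSeq (ar s) fun i => termCuts (ts i)).map fun p => (STerm.node s p.1, p.2) := by
  classical
  unfold termCuts
  rw [univ_map_equiv (Factorization.equiv s ts), univ_map_option, cutSeq_univ, Multiset.map_map]
  congr 1
  · simp only [Factorization.equiv, Equiv.ofBijective_apply, Factorization.build]
    congr 1
    exact rd_node s ts
  · refine Multiset.map_congr rfl fun c _ => ?_
    simp only [Factorization.equiv, Equiv.ofBijective_apply, Factorization.build,
      Function.comp_def]
    congr 1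
    have := ofFn_finSigma (m := fun i => (c i).1.1.arity) fun q => (c q.1).1.2 q.2
    refine (congrArg rd this).trans ?_
    rw [rd_flatten, List.map_ofFn]
    rfl

variable (ar) in
/-- The system of cuts of terms. -/
noncomputable def termSystem : CutSystem (STerm ar) (NTerm ar) where
  leaf := STerm.leaf
  inc := Subtype.val
  toWord t := rd [t]
  cuts := termCuts
  deg := STerm.deg
  toWord_leaf := rd_leaf
  toWord_inc := rd_val
  cuts_leaf := termCuts_leaf
  deg_leaf := rfl
  ind := by
    intro P h0 h1 t
    induction t with
    | leaf => exact h0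
    | node s ts ih =>
      exact h1 (ar s) (fun us => ⟨STerm.node s us, by simp⟩) (fun us => termCuts_node s us)
        (fun us => rfl) ts ih

theorem natCoprod_E (f : List (NTerm ar)) :
    natCoprod ar K (E K f) = sumE (cutWord (termSystem ar).letterCuts f) := by
  induction f with
  | nil => simp [natCoprod, liftWord_E, cutWord, sumE_nil]
  | cons x f ih =>
    have e : natCoprod ar K (E K [x]) = sumE ((termSystem ar).letterCuts x) := by
      rw [natCoprod, liftWord_E]
      simp only [List.map_cons, List.map_nil, List.prod_cons, List.prod_nil, mul_one]
      rw [coprodTerm, finsum_eq_sum_of_fintype, sumE, CutSystem.letterCuts, Multiset.map_map]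
      simp only [termSystem, termCuts, Multiset.map_map, Function.comp_def, Finset.sum]
    have h : x :: f = [x] ++ f := rfl
    rw [h, E_append, map_mul, e, ih, List.singleton_append, cutWord, sumE_mul]

/-- The natural Hopf algebra of the free operad. -/
noncomputable instance : HopfAlgebra K (NatFree ar K) :=
  (termSystem ar).hopf (natCoprod ar K) (natCoprod_E K)

theorem comul_natFree (x : NatFree ar K) : Coalgebra.comul x = natCoprod ar K x := rfl

end Terms

/-! ### Nodes of forests -/

section Nodes

/-- The nodes of a forest (a word of trees), given the nodes of each tree. -/
inductive ForestNode {X : Type*} (Nd : X → Type*) : List X → Type _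
  | here {t : X} {f : List X} (x : Nd t) : ForestNode Nd (t :: f)
  | there {t : X} {f : List X} (x : ForestNode Nd f) : ForestNode Nd (t :: f)

/-- A relation between the nodes of each tree, seen on the nodes of a forest (nodes of different
trees are not related). -/
inductive ForestNode.Rel {X : Type*} {Nd : X → Type*} (R : ∀ t : X, Nd t → Nd t → Prop) :
    {f : List X} → ForestNode Nd f → ForestNode Nd f → Prop
  | here {t : X} {f : List X} {x y : Nd t} (h : R t x y) :
      Rel R (.here x : ForestNode Nd (t :: f)) (.here y)
  | there {t : X} {f : List X} {x y : ForestNode Nd f} (h : Rel R x y) :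
      Rel R (.there x : ForestNode Nd (t :: f)) (.there y)

end Nodes

/-! ### Trimmed forests -/

section Trimmed
variable {S : Type*} (ar : S → ℕ)

/-- Nonempty planar rooted trees such that each node is decorated by an element `s` of `S` and has
at most `ar s` children. Trimmed forests are the words of trimmed trees, that is, the elements of
`List (TrimTree ar)`. -/
inductive TrimTree : Type _
  | node (s : S) (k : ℕ) (hk : k ≤ ar s) (ts : Fin k → TrimTree) : TrimTree

variable {ar}

namespace TrimTree

/-- The tree with root decorated by `s` attached to a forest. -/
def graftRoot (s : S) (f : List (TrimTree ar)) (hf : f.length ≤ ar s) : TrimTree ar :=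
  node s f.length hf f.get

/-- The nodes of a trimmed tree. -/
inductive Node : TrimTree ar → Type _
  | root (s : S) (k : ℕ) (hk : k ≤ ar s) (ts : Fin k → TrimTree ar) : Node (node s k hk ts)
  | child (s : S) (k : ℕ) (hk : k ≤ ar s) (ts : Fin k → TrimTree ar) (i : Fin k)
      (x : Node (ts i)) : Node (node s k hk ts)

/-- `Anc t x y` means that the node `x` is a (proper) ancestor of the node `y`, that is, `y` is a
(proper) descendant of `x`. -/
inductive Anc : (t : TrimTree ar) → Node t → Node t → Prop
  | root (s : S) (k : ℕ) (hk : k ≤ ar s) (ts : Fin k → TrimTree ar) (i : Fin k)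
      (y : Node (ts i)) : Anc (node s k hk ts) (.root s k hk ts) (.child s k hk ts i y)
  | child (s : S) (k : ℕ) (hk : k ≤ ar s) (ts : Fin k → TrimTree ar) (i : Fin k)
      (x y : Node (ts i)) (h : Anc (ts i) x y) :
      Anc (node s k hk ts) (.child s k hk ts i x) (.child s k hk ts i y)

theorem reduceOption_ofFn_length {X : Type*} {k n : ℕ} (hk : k ≤ n) (us : Fin k → Option X) :
    (List.ofFn us).reduceOption.length ≤ n :=
  (List.reduceOption_length_le _).trans (by simpa using hk)

open Classical in
/-- The restriction of a tree to a set `I` of nodes, where only the nodes of `I` and the edges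
between them are kept: the connected component of the root of the tree (`none` if the root does not
belong to `I`), and the word of the other components, ordered by the preorder of their roots. -/
noncomputable def split : (t : TrimTree ar) → Set (Node t) →
    Option (TrimTree ar) × List (TrimTree ar)
  | node s k hk ts, I =>
    let r : Fin k → Option (TrimTree ar) × List (TrimTree ar) :=
      fun i => (ts i).split {x | Node.child s k hk ts i x ∈ I}
    if Node.root s k hk ts ∈ I then
      (some (graftRoot s (List.ofFn fun i => (r i).1).reduceOption
        (reduceOption_ofFn_length hk _)), (List.ofFn fun i => (r i).2).flatten)
    else (none, (List.ofFn fun i => (r i).1.toList ++ (r i).2).flatten)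

/-- The restriction of a tree to a set of nodes, as a forest. -/
noncomputable def restrict (t : TrimTree ar) (I : Set (Node t)) : List (TrimTree ar) :=
  (t.split I).1.toList ++ (t.split I).2

end TrimTree

/-- The nodes of a trimmed forest. -/
abbrev TrimNode (f : List (TrimTree ar)) : Type _ := ForestNode TrimTree.Node f

/-- The ancestor relation on the nodes of a trimmed forest. -/
abbrev TrimAnc {f : List (TrimTree ar)} (x y : TrimNode f) : Prop :=
  ForestNode.Rel TrimTree.Anc x y

/-- The restriction of a trimmed forest to a set of nodes. -/
noncomputable def restrictForest : (f : List (TrimTree ar)) → Set (TrimNode f) → List (TrimTree ar)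
  | [], _ => []
  | t :: f, I => t.restrict {x | ForestNode.here x ∈ I} ++
      restrictForest f {x | ForestNode.there x ∈ I}

/-- Admissible pairs `(I₁, I₂)` of sets of nodes of `f`: every node belongs to exactly one of the
two sets, `I₁` is closed under ancestors and `I₂` is closed under descendants. -/
structure Admissible (f : List (TrimTree ar)) (I : Set (TrimNode f) × Set (TrimNode f)) : Prop where
  union : I.1 ∪ I.2 = Set.univ
  disjoint : Disjoint I.1 I.2
  ancestors : ∀ x ∈ I.1, ∀ y, TrimAnc y x → y ∈ I.1
  descendants : ∀ x ∈ I.2, ∀ y, TrimAnc x y → y ∈ I.2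

variable (ar) in
/-- The underlying algebra of the noncommutative Connes–Kreimer Hopf algebra of trimmed forests:
the span of the trimmed forests, with the concatenation product. -/
abbrev NCK (K : Type*) [Field K] : Type _ := WordAlg K (TrimTree ar)

variable (K : Type*) [Field K]

variable (ar) in
/-- The coproduct `Δ E_f = ∑ E_{f(I₁)} ⊗ E_{f(I₂)}`, where `(I₁, I₂)` runs over the admissible
pairs of sets of nodes of `f` (a finite sum). -/
noncomputable def nckCoprod : NCK ar K →ₗ[K] NCK ar K ⊗[K] NCK ar K :=
  (eBasis K (TrimTree ar)).constr K fun f =>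
    ∑ᶠ I : {I : Set (TrimNode f) × Set (TrimNode f) // Admissible f I},
      E K (restrictForest f I.1.1) ⊗ₜ[K] E K (restrictForest f I.1.2)

/-! Auxiliary: recursive description of the admissible pairs. -/

namespace TrimTree

/-- Sets of nodes closed under ancestors. -/
def Up (t : TrimTree ar) : Type _ := {I : Set (Node t) // ∀ x ∈ I, ∀ y, Anc t y x → y ∈ I}

theorem anc_child_iff {s : S} {k : ℕ} {hk : k ≤ ar s} {ts : Fin k → TrimTree ar} {i : Fin k}
    {x : Node (ts i)} {y : Node (node s k hk ts)} :
    Anc _ y (.child s k hk ts i x) ↔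
      y = .root s k hk ts ∨ ∃ z, y = .child s k hk ts i z ∧ Anc (ts i) z x := by
  constructor
  · intro h
    cases h with
    | root => exact Or.inl rfl
    | child _ _ _ _ _ z _ h => exact Or.inr ⟨z, rfl, h⟩
  · rintro (rfl | ⟨z, rfl, h⟩)
    · exact .root ..
    · exact .child _ _ _ _ _ _ _ h

theorem not_anc_root {s : S} {k : ℕ} {hk : k ≤ ar s} {ts : Fin k → TrimTree ar}
    {y : Node (node s k hk ts)} : ¬ Anc _ y (.root s k hk ts) := by
  intro h; cases h

/-- The set of nodes made of the root and of given sets of nodes of the children. -/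
def rootSet {s : S} {k : ℕ} (hk : k ≤ ar s) {ts : Fin k → TrimTree ar}
    (c : ∀ i, Set (Node (ts i))) : Set (Node (node s k hk ts)) :=
  {x | match x with
    | .root _ _ _ _ => True
    | .child _ _ _ _ i y => y ∈ c i}

/-- Sets closed under ancestors, from the ones of the children. -/
def Up.build (s : S) (k : ℕ) (hk : k ≤ ar s) (ts : Fin k → TrimTree ar) :
    Option (∀ i, Up (ts i)) → Up (node s k hk ts)
  | none => ⟨∅, fun _ h => h.elim⟩
  | some c => ⟨rootSet hk fun i => (c i).1, by
      rintro x hx y hy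
      cases x with
      | root => exact (not_anc_root hy).elim
      | child _ _ _ _ i x =>
        rcases anc_child_iff.1 hy with rfl | ⟨z, rfl, h⟩
        · exact trivial
        · exact (c i).2 x hx z h⟩

theorem Up.build_bijective (s : S) (k : ℕ) (hk : k ≤ ar s) (ts : Fin k → TrimTree ar) :
    Function.Bijective (Up.build s k hk ts) := by
  constructor
  · intro c d h
    have h' := fun x => Set.ext_iff.1 (congrArg Subtype.val h) x
    cases c with
    | none =>
      cases d with
      | none => rfl
      | some d => exact ((h' (.root s k hk ts)).2 trivial).elim
    | some c =>
      cases d with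
      | none => exact ((h' (.root s k hk ts)).1 trivial).elim
      | some d =>
        congr 1
        funext i
        exact Subtype.ext (Set.ext fun x => h' (.child s k hk ts i x))
  · intro I
    by_cases hr : Node.root s k hk ts ∈ I.1
    · refine ⟨some fun i => ⟨{x | Node.child s k hk ts i x ∈ I.1}, fun x hx y hy =>
        I.2 _ hx _ (.child _ _ _ _ _ _ _ hy)⟩, Subtype.ext (Set.ext fun x => ?_)⟩
      cases x with
      | root => exact ⟨fun _ => hr, fun _ => trivial⟩
      | child _ _ _ _ i x => exact Iff.rfl
    · refine ⟨none, Subtype.ext (Set.ext fun x => ⟨fun h => h.elim, fun hx => hr ?_⟩)⟩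
      cases x with
      | root => exact hx
      | child _ _ _ _ i x => exact I.2 _ hx _ (.root ..)

/-- Recursive description of the sets of nodes closed under ancestors, as an equivalence. -/
noncomputable def Up.equiv (s : S) (k : ℕ) (hk : k ≤ ar s) (ts : Fin k → TrimTree ar) :
    Option (∀ i, Up (ts i)) ≃ Up (node s k hk ts) :=
  Equiv.ofBijective _ (Up.build_bijective s k hk ts)

theorem Up.finite (t : TrimTree ar) : Finite (Up t) := by
  induction t with
  | node s k hk ts ih => exact Finite.of_equiv _ (Up.equiv s k hk ts)

noncomputable instance upFintype (t : TrimTree ar) : Fintype (Up t) :=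
  haveI := Up.finite t
  Fintype.ofFinite _

theorem split_empty (t : TrimTree ar) : t.split ∅ = (none, []) := by
  induction t with
  | node s k hk ts ih =>
    simp [split, ih]

theorem graftRoot_ofFn (s : S) (k : ℕ) (hk : k ≤ ar s) (ts : Fin k → TrimTree ar)
    (f : List (TrimTree ar)) (hf : f.length ≤ ar s) (h : f = List.ofFn ts) :
    graftRoot s f hf = node s k hk ts := by
  subst h
  unfold graftRoot
  have : ∀ (n : ℕ) (e : n = k) (hn : n ≤ ar s) (us : Fin n → TrimTree ar),
      (∀ i, us i = ts (Fin.cast e i)) → node s n hn us = node s k hk ts := by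
    rintro n rfl hn us h
    congr 1
    exact funext h
  refine this _ (List.length_ofFn) _ _ fun i => ?_
  simp [List.get_eq_getElem]
  rfl

theorem reduceOption_ofFn_some {X : Type*} {k : ℕ} (ts : Fin k → X) :
    (List.ofFn fun i => some (ts i)).reduceOption = List.ofFn ts := by
  induction k with
  | zero => rfl
  | succ k ih =>
    rw [List.ofFn_succ, List.ofFn_succ, List.reduceOption_cons_of_some, ih]

theorem split_univ (t : TrimTree ar) : t.split Set.univ = (some t, []) := by
  induction t with
  | node s k hk ts ih =>
    simp only [split, Set.mem_univ, Set.ofPred_true, ih, if_true]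
    congr 1
    · congr 1
      exact graftRoot_ofFn _ _ _ _ _ _ (reduceOption_ofFn_some ts)
    · simp

theorem split_up (t : TrimTree ar) (I : Up t) : (t.split I.1).2 = [] := by
  induction t with
  | node s k hk ts ih =>
    obtain ⟨c, rfl⟩ := (Up.build_bijective s k hk ts).2 I
    cases c with
    | none => exact congrArg Prod.snd (split_empty _)
    | some c =>
      have h : Node.root s k hk ts ∈ (Up.build s k hk ts (some c)).1 := trivial
      simp only [split, if_pos h]
      have : ∀ i, (split (ts i) {x | Node.child s k hk ts i x ∈
          (Up.build s k hk ts (some c)).1}).2 = [] := fun i => ih i (c i)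
      simp [this]

/-- The pairs (component of the root, complement) for the sets closed under ancestors. -/
noncomputable def treeCuts (t : TrimTree ar) :
    Multiset (Option (TrimTree ar) × List (TrimTree ar)) :=
  (Finset.univ : Finset (Up t)).val.map fun I => ((t.split I.1).1, t.restrict I.1ᶜ)

theorem treeCuts_node (s : S) (k : ℕ) (hk : k ≤ ar s) (ts : Fin k → TrimTree ar) :
    treeCuts (node s k hk ts) = (none, [node s k hk ts]) ::ₘ
      (cutSeq k fun i => treeCuts (ts i)).map fun p =>
        (some (graftRoot s (List.ofFn p.1).reduceOption (reduceOption_ofFn_length hk _)), p.2) := by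
  classical
  unfold treeCuts
  rw [univ_map_equiv (Up.equiv s k hk ts), univ_map_option, cutSeq_univ, Multiset.map_map]
  congr 1
  · simp only [Up.equiv, Equiv.ofBijective_apply, Up.build, Set.compl_empty, restrict, split_univ,
      split_empty]
    rfl
  · refine Multiset.map_congr rfl fun c _ => ?_
    have h : Node.root s k hk ts ∈ (Up.build s k hk ts (some c)).1 := trivial
    have h' : Node.root s k hk ts ∉ (Up.build s k hk ts (some c)).1ᶜ := fun h' => h' h
    simp only [Up.equiv, Equiv.ofBijective_apply, restrict, split, if_pos h, if_neg h',
      Function.comp_def]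
    rfl

/-- Cuts of a possibly empty tree. -/
noncomputable def optCuts : Option (TrimTree ar) →
    Multiset (Option (TrimTree ar) × List (TrimTree ar))
  | none => {(none, [])}
  | some t => treeCuts t

theorem cutSeq_optCuts {k : ℕ} (us : Fin k → Option (TrimTree ar)) :
    (cutSeq k fun i => optCuts (us i)).map
        (fun p => ((List.ofFn p.1).reduceOption, p.2)) =
      cutWord (fun t => (treeCuts t).map fun p => (p.1.toList, p.2))
        (List.ofFn us).reduceOption := by
  induction k with
  | zero => simp [cutSeq, cutWord]
  | succ k ih =>
    have ih' := ih fun i => us i.succ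
    rw [List.ofFn_succ]
    have key : ∀ m : Multiset (Option (TrimTree ar) × List (TrimTree ar)),
        (m.bind fun p => (cutSeq k fun i => optCuts (us i.succ)).map fun q =>
          ((List.ofFn (Fin.cons p.1 q.1 : Fin (k + 1) → Option (TrimTree ar))).reduceOption,
            p.2 ++ q.2)) =
        m.bind fun p => (cutWord (fun t => (treeCuts t).map fun p => (p.1.toList, p.2))
          (List.ofFn fun i => us i.succ).reduceOption).map fun q =>
            (p.1.toList ++ q.1, p.2 ++ q.2) := by
      intro m
      refine Multiset.bind_congr fun p _ => ?_
      rw [← ih', Multiset.map_map]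
      refine Multiset.map_congr rfl fun q _ => ?_
      simp only [List.ofFn_succ, Fin.cons_zero, Fin.cons_succ, Function.comp_def]
      congr 1
      cases p.1 <;> simp
    simp only [cutSeq, Multiset.map_bind, Multiset.map_map, Function.comp_def, key]
    cases us 0 with
    | none => simp [optCuts]
    | some t => simp [optCuts, cutWord, Multiset.bind_map]

theorem optCuts_graftRoot (s : S) (f : List (TrimTree ar)) (hf : f.length ≤ ar s) :
    optCuts (some (graftRoot s f hf)) = (none, [graftRoot s f hf]) ::ₘ
      (cutWord (fun t => (treeCuts t).map fun p => (p.1.toList, p.2)) f).map fun p =>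
        (if h : p.1.length ≤ ar s then some (graftRoot s p.1 h) else none, p.2) := by
  have e : f = (List.ofFn fun i => some (f.get i)).reduceOption := by
    rw [reduceOption_ofFn_some, List.ofFn_get]
  rw [show ∀ c : TrimTree ar → Multiset (List (TrimTree ar) × List (TrimTree ar)),
    cutWord c f = cutWord c (List.ofFn fun i => some (f.get i)).reduceOption from
      fun c => congrArg _ e, ← cutSeq_optCuts, Multiset.map_map]
  simp only [optCuts]
  rw [graftRoot, treeCuts_node]
  congr 1
  refine Multiset.map_congr rfl fun p _ => ?_
  simp only [Function.comp_def]
  rw [dif_pos (reduceOption_ofFn_length hf _)]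

theorem optCuts_node (s : S) {k : ℕ} (hk : k ≤ ar s) (us : Fin k → Option (TrimTree ar)) :
    optCuts (some (graftRoot s (List.ofFn us).reduceOption (reduceOption_ofFn_length hk us))) =
      (none, [graftRoot s (List.ofFn us).reduceOption (reduceOption_ofFn_length hk us)]) ::ₘ
        (cutSeq k fun i => optCuts (us i)).map fun p =>
          (some (graftRoot s (List.ofFn p.1).reduceOption (reduceOption_ofFn_length hk _)),
            p.2) := by
  rw [optCuts_graftRoot, ← cutSeq_optCuts, Multiset.map_map]
  congr 1
  refine Multiset.map_congr rfl fun p _ => ?_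
  simp only [Function.comp_def]
  rw [dif_pos (reduceOption_ofFn_length hk _)]

/-- The number of nodes. -/
def deg : TrimTree ar → ℕ
  | node _ _ _ ts => 1 + ∑ i, (ts i).deg

/-- The number of nodes of a possibly empty tree. -/
def optDeg : Option (TrimTree ar) → ℕ
  | none => 0
  | some t => t.deg

theorem sum_reduceOption {k : ℕ} (us : Fin k → Option (TrimTree ar)) :
    ((List.ofFn us).reduceOption.map deg).sum = ∑ i, optDeg (us i) := by
  induction k with
  | zero => simp
  | succ k ih =>
    rw [List.ofFn_succ, Fin.sum_univ_succ, ← ih]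
    cases us 0 <;> simp [optDeg]

theorem optDeg_node (s : S) {k : ℕ} (hk : k ≤ ar s) (us : Fin k → Option (TrimTree ar)) :
    optDeg (some (graftRoot s (List.ofFn us).reduceOption (reduceOption_ofFn_length hk us))) =
      1 + ∑ i, optDeg (us i) := by
  rw [← sum_reduceOption, optDeg, graftRoot, deg, ← List.sum_ofFn]
  congr 2
  conv_rhs => rw [← List.ofFn_get (List.ofFn us).reduceOption, List.map_ofFn]
  rfl

variable (ar) in
/-- The system of cuts of trimmed trees. -/
noncomputable def trimSystem : CutSystem (Option (TrimTree ar)) (TrimTree ar) where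
  leaf := none
  inc := some
  toWord := Option.toList
  cuts := optCuts
  deg := optDeg
  toWord_leaf := rfl
  toWord_inc _ := rfl
  cuts_leaf := rfl
  deg_leaf := rfl
  ind := by
    intro P h0 h1 t
    cases t with
    | none => exact h0
    | some t =>
      induction t with
      | node s k hk ts ih =>
        have := h1 k _ (optCuts_node s hk) (optDeg_node s hk) (fun i => some (ts i)) ih
        rwa [graftRoot_ofFn s k hk ts _ _ (reduceOption_ofFn_some ts)] at this

end TrimTree

/-- Sets of nodes of a forest closed under ancestors. -/
def UpForest (f : List (TrimTree ar)) : Type _ :=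
  {I : Set (TrimNode f) // ∀ x ∈ I, ∀ y, TrimAnc y x → y ∈ I}

theorem rel_here_iff {t : TrimTree ar} {f : List (TrimTree ar)} {x : t.Node}
    {y : TrimNode (t :: f)} :
    TrimAnc y (ForestNode.here x) ↔ ∃ z, y = ForestNode.here z ∧ TrimTree.Anc t z x := by
  constructor
  · intro h
    cases h with
    | here h => exact ⟨_, rfl, h⟩
  · rintro ⟨z, rfl, h⟩
    exact .here h

theorem rel_there_iff {t : TrimTree ar} {f : List (TrimTree ar)} {x : TrimNode f}
    {y : TrimNode (t :: f)} :
    TrimAnc y (ForestNode.there x) ↔ ∃ z, y = ForestNode.there z ∧ TrimAnc z x := by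
  constructor
  · intro h
    cases h with
    | there h => exact ⟨_, rfl, h⟩
  · rintro ⟨z, rfl, h⟩
    exact .there h

/-- A set of nodes of a forest, tree by tree. -/
def consSet {t : TrimTree ar} {f : List (TrimTree ar)} (I : Set t.Node) (J : Set (TrimNode f)) :
    Set (TrimNode (t :: f)) :=
  {x | match x with
    | .here y => y ∈ I
    | .there y => y ∈ J}

/-- Decomposition of the sets closed under ancestors, tree by tree. -/
def UpForest.equivCons (t : TrimTree ar) (f : List (TrimTree ar)) :
    t.Up × UpForest f ≃ UpForest (t :: f) where
  toFun p := ⟨consSet p.1.1 p.2.1, by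
    intro x hx y hy
    cases x with
    | here x =>
      obtain ⟨z, rfl, h⟩ := rel_here_iff.1 hy
      exact p.1.2 x hx z h
    | there x =>
      obtain ⟨z, rfl, h⟩ := rel_there_iff.1 hy
      exact p.2.2 x hx z h⟩
  invFun I := (⟨{x | ForestNode.here x ∈ I.1}, fun _ hx _ hy => I.2 _ hx _ (.here hy)⟩,
    ⟨{x | ForestNode.there x ∈ I.1}, fun _ hx _ hy => I.2 _ hx _ (.there hy)⟩)
  left_inv _ := rfl
  right_inv _ := by
    refine Subtype.ext (Set.ext fun x => ?_)
    cases x <;> exact Iff.rfl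

instance : Unique (UpForest ([] : List (TrimTree ar))) where
  default := ⟨∅, fun _ h => h.elim⟩
  uniq _ := Subtype.ext (Set.ext fun x => nomatch x)

theorem UpForest.finite (f : List (TrimTree ar)) : Finite (UpForest f) := by
  induction f with
  | nil => infer_instance
  | cons t f ih => exact Finite.of_equiv _ (UpForest.equivCons t f)

noncomputable instance (f : List (TrimTree ar)) : Fintype (UpForest f) :=
  haveI := UpForest.finite f
  Fintype.ofFinite _

/-- Admissible pairs are determined by their first component. -/
def UpForest.equivAdmissible (f : List (TrimTree ar)) :
    UpForest f ≃ {I : Set (TrimNode f) × Set (TrimNode f) // Admissible f I} where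
  toFun I := ⟨(I.1, I.1ᶜ), Set.union_compl_self _, disjoint_compl_right, I.2,
    fun _ hx _ hy h => hx (I.2 _ h _ hy)⟩
  invFun I := ⟨I.1.1, I.2.ancestors⟩
  left_inv _ := rfl
  right_inv I := by
    refine Subtype.ext (Prod.ext rfl ?_)
    have h : IsCompl I.1.1 I.1.2 := ⟨I.2.disjoint, codisjoint_iff.2 I.2.union⟩
    exact h.compl_eq

theorem forestCuts (f : List (TrimTree ar)) :
    ((Finset.univ : Finset (UpForest f)).val.map fun I =>
      (restrictForest f I.1, restrictForest f I.1ᶜ)) =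
    cutWord (TrimTree.trimSystem ar).letterCuts f := by
  induction f with
  | nil =>
    have : (Finset.univ : Finset (UpForest ([] : List (TrimTree ar)))) = {default} := by
      ext c
      simp [Unique.eq_default c]
    rw [this]
    rfl
  | cons t f ih =>
    rw [univ_map_equiv (UpForest.equivCons t f), univ_map_prod, cutWord, ← ih]
    simp only [CutSystem.letterCuts, TrimTree.trimSystem, TrimTree.optCuts, TrimTree.treeCuts,
      Multiset.map_map, Multiset.bind_map, Function.comp_def]
    refine Multiset.bind_congr fun I _ => Multiset.map_congr rfl fun J _ => ?_
    simp only [restrictForest]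
    refine Prod.ext ?_ rfl
    change t.restrict I.1 ++ _ = (t.split I.1).1.toList ++ _
    rw [TrimTree.restrict, TrimTree.split_up, List.append_nil]
    rfl

theorem nckCoprod_E (f : List (TrimTree ar)) :
    nckCoprod ar K (E K f) = sumE (cutWord (TrimTree.trimSystem ar).letterCuts f) := by
  rw [nckCoprod, ← eBasis_apply, Module.Basis.constr_basis,
    ← finsum_comp_equiv (UpForest.equivAdmissible f), finsum_eq_sum_of_fintype, ← forestCuts,
    sumE, Multiset.map_map]
  rfl

variable (ar) in
/-- The coproduct, as an algebra morphism. -/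
noncomputable def nckCoprodAlgHom : NCK ar K →ₐ[K] NCK ar K ⊗[K] NCK ar K :=
  AlgHom.ofLinearMap (nckCoprod ar K)
    (by rw [← E_nil, nckCoprod_E, cutWord, sumE_nil])
    (by
      intro x y
      revert x
      refine word_induction (fun f => ?_) (fun a b ha hb => ?_) (fun c a ha => ?_)
      · revert y
        refine word_induction (fun g => ?_) (fun a b ha hb => ?_) (fun c a ha => ?_)
        · rw [← E_append, nckCoprod_E, nckCoprod_E, nckCoprod_E, cutWord_append, sumE_mul]
        · rw [mul_add, map_add, map_add, ha, hb, mul_add]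
        · rw [mul_smul_comm, map_smul, map_smul, ha, mul_smul_comm]
      · rw [add_mul, map_add, map_add, ha, hb, add_mul]
      · rw [smul_mul_assoc, map_smul, map_smul, ha, smul_mul_assoc])

/-- The noncommutative Connes–Kreimer Hopf algebra of trimmed forests. -/
noncomputable instance : HopfAlgebra K (NCK ar K) :=
  (TrimTree.trimSystem ar).hopf (nckCoprodAlgHom ar K) (nckCoprod_E K)

theorem comul_nck (x : NCK ar K) : Coalgebra.comul x = nckCoprod ar K x := rfl

end Trimmed

/-! ### Trimming -/

section Trim
variable {S : Type*} {ar : S → ℕ}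

/-- Removal of the leaves of a term: the leaf gives nothing, and the other terms give a trimmed
tree. -/
def STerm.tr : STerm ar → Option (TrimTree ar)
  | leaf => none
  | node s ts => some (TrimTree.graftRoot s (List.ofFn fun i => (ts i).tr).reduceOption
      (TrimTree.reduceOption_ofFn_length le_rfl _))

/-- The trimmed forest `tr f` obtained by removing the leaves of a reduced forest `f`. -/
def tr (f : List (NTerm ar)) : List (TrimTree ar) := f.filterMap fun t => t.1.tr

end Trim

/-! ### Forest-like alphabets and the realizing map -/

section Realization
variable {S : Type*}

/-- A forest-like alphabet on the set `S`: a set of letters with a root relation, decoration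
relations, and edge relations. -/
structure ForestLikeAlphabet (S : Type*) where
  Letter : Type*
  root : Set Letter
  deco : S → Set Letter
  edge : ℕ+ → Letter → Letter → Prop

namespace ForestLikeAlphabet

/-- The quotient of an alphabet by an equivalence relation. -/
def quotient (A : ForestLikeAlphabet S) (r : Setoid A.Letter) : ForestLikeAlphabet S where
  Letter := Quotient r
  root := {x | ∃ a ∈ A.root, Quotient.mk r a = x}
  deco s := {x | ∃ a ∈ A.deco s, Quotient.mk r a = x}
  edge j x y := ∃ a b, A.edge j a b ∧ Quotient.mk r a = x ∧ Quotient.mk r b = y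

variable (S) in
/-- The alphabet of positions: the letters are the `a^s_u` with `s ∈ S` and `u` a word on `ℕ`. -/
def positions : ForestLikeAlphabet S where
  Letter := S × List ℕ
  root := {a | ∃ l, a.2 = List.replicate l 0}
  deco s := {a | a.1 = s}
  edge j a b := ∃ l, b.2 = a.2 ++ [(j : ℕ)] ++ List.replicate l 0

variable (S) in
/-- The alphabet of lengths: the quotient of the alphabet of positions identifying `a^s_u` and
`a^s_v` when `u` and `v` have the same length. -/
def lengths : ForestLikeAlphabet S :=
  (positions S).quotient (Setoid.ker fun a : S × List ℕ => (a.1, a.2.length))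

end ForestLikeAlphabet

/-- The noncommutative polynomials on an alphabet: formal series in the words, of finite degree
and with a possibly infinite support. -/
def NCPoly (K : Type*) [Field K] (A : Type*) : Submodule K (List A → K) where
  carrier := {p | ∃ d : ℕ, ∀ w : List A, d < w.length → p w = 0}
  add_mem' := by
    rintro p q ⟨d, hd⟩ ⟨e, he⟩
    exact ⟨max d e, fun w hw => by
      rw [Pi.add_apply, hd w (lt_of_le_of_lt (le_max_left ..) hw),
        he w (lt_of_le_of_lt (le_max_right ..) hw), add_zero]⟩
  zero_mem' := ⟨0, fun _ _ => rfl⟩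
  smul_mem' := by
    rintro c p ⟨d, hd⟩
    exact ⟨d, fun w hw => by rw [Pi.smul_apply, hd w hw, smul_zero]⟩

variable {ar : S → ℕ}

namespace STerm

/-- The internal nodes of a term. -/
inductive Node : STerm ar → Type _
  | root (s : S) (ts : Fin (ar s) → STerm ar) : Node (node s ts)
  | child (s : S) (ts : Fin (ar s) → STerm ar) (i : Fin (ar s)) (x : Node (ts i)) : Node (node s ts)

/-- The decoration of an internal node. -/
def Node.deco : {t : STerm ar} → Node t → S
  | _, .root s _ => s
  | _, .child _ _ _ x => x.deco

/-- The property of being the root of the term. -/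
def Node.IsRoot : {t : STerm ar} → Node t → Prop
  | _, .root _ _ => True
  | _, .child _ _ _ _ => False

/-- `Edge j t x y` means that the node `y` is the `j`-th child of the node `x` in `t`. -/
inductive Edge (j : ℕ+) : (t : STerm ar) → Node t → Node t → Prop
  | root (s : S) (ts : Fin (ar s) → STerm ar) (i : Fin (ar s)) (hi : (j : ℕ) = i + 1)
      (y : Node (ts i)) (hy : y.IsRoot) : Edge j (node s ts) (.root s ts) (.child s ts i y)
  | child (s : S) (ts : Fin (ar s) → STerm ar) (i : Fin (ar s)) (x y : Node (ts i))
      (h : Edge j (ts i) x y) : Edge j (node s ts) (.child s ts i x) (.child s ts i y)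

/-- The word of the labels `a x` of the internal nodes `x`, listed in left to right preorder. -/
def preorder {L : Type*} : (t : STerm ar) → (Node t → L) → List L
  | leaf, _ => []
  | node s ts, a => a (.root s ts) ::
      (List.ofFn fun i => (ts i).preorder fun x => a (.child s ts i x)).flatten

theorem preorder_length {L : Type*} (t : STerm ar) (a : Node t → L) :
    (t.preorder a).length = t.deg := by
  induction t with
  | leaf => rfl
  | node s ts ih =>
    simp only [preorder, List.length_cons, List.length_flatten, List.map_ofFn, Function.comp_def,
      ih, List.sum_ofFn, deg]
    omega

end STerm

/-- The internal nodes of a reduced forest. -/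
abbrev NodeOf (f : List (NTerm ar)) : Type _ := ForestNode (fun t : NTerm ar => t.1.Node) f

/-- The decoration of an internal node of a reduced forest. -/
def NodeOf.deco : {f : List (NTerm ar)} → NodeOf f → S
  | _, .here x => x.deco
  | _, .there x => NodeOf.deco x

/-- The property of being one of the roots of the forest. -/
def NodeOf.IsRoot : {f : List (NTerm ar)} → NodeOf f → Prop
  | _, .here x => x.IsRoot
  | _, .there x => NodeOf.IsRoot x

/-- The node `y` is the `j`-th child of the node `x` in the forest. -/
abbrev NodeOf.Edge (j : ℕ+) {f : List (NTerm ar)} (x y : NodeOf f) : Prop :=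
  ForestNode.Rel (fun t : NTerm ar => STerm.Edge j t.1) x y

/-- The word of the labels of the internal nodes of a forest, listed in left to right preorder. -/
def preorderForest {L : Type*} : (f : List (NTerm ar)) → (NodeOf f → L) → List L
  | [], _ => []
  | t :: f, a => (t.1.preorder fun x => a (.here x)) ++ preorderForest f fun x => a (.there x)

/-- The degree (number of internal nodes) of a reduced forest. -/
def forestDeg (f : List (NTerm ar)) : ℕ := (f.map fun t => t.1.deg).sum

/-- The word `w` on the alphabet `A` is compatible with the reduced forest `f`: the length of `w` is
the number of internal nodes of `f` and, `a x` being the letter of `w` at the position of the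
node `x` in preorder, roots have their letter in the root relation, a node decorated by
`s` has its letter in the `s`-decoration relation, and the letters of a node and of its `j`-th
child are in the `j`-edge relation. -/
def Compatible (A : ForestLikeAlphabet S) (f : List (NTerm ar)) (w : List A.Letter) : Prop :=
  ∃ a : NodeOf f → A.Letter, preorderForest f a = w ∧
    (∀ x, NodeOf.IsRoot x → a x ∈ A.root) ∧
    (∀ x, a x ∈ A.deco (NodeOf.deco x)) ∧
    ∀ (j : ℕ+) (x y : NodeOf f), NodeOf.Edge j x y → A.edge j (a x) (a y)

theorem preorderForest_length {L : Type*} (f : List (NTerm ar)) (a : NodeOf f → L) :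
    (preorderForest f a).length = forestDeg f := by
  induction f with
  | nil => rfl
  | cons t f ih =>
    simp only [preorderForest, List.length_append, STerm.preorder_length, ih, forestDeg,
      List.map_cons, List.sum_cons]

theorem Compatible.length {A : ForestLikeAlphabet S} {f : List (NTerm ar)} {w : List A.Letter}
    (h : Compatible A f w) : w.length = forestDeg f := by
  obtain ⟨a, rfl, -⟩ := h
  exact preorderForest_length f a

variable (K : Type*) [Field K]

open Classical in
variable (ar) in
/-- The realizing map `r_A`, sending `E_f` to the sum of the words compatible with `f`. -/
noncomputable def realize (A : ForestLikeAlphabet S) : NatFree ar K →ₗ[K] NCPoly K A.Letter :=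
  (eBasis K (NTerm ar)).constr K fun f =>
    ⟨fun w => if Compatible A f w then 1 else 0, forestDeg f, fun w hw =>
      if_neg fun h => by rw [h.length] at hw; exact lt_irrefl _ hw⟩

/-! Auxiliary: the kernel of the realizing map is a two-sided ideal. -/

open Classical in
theorem realize_E (A : ForestLikeAlphabet S) (f : List (NTerm ar)) (w : List A.Letter) :
    (realize ar K A (E K f)).1 w = if Compatible A f w then 1 else 0 := by
  rw [realize, ← eBasis_apply, Module.Basis.constr_basis]

theorem compatible_cons {A : ForestLikeAlphabet S} {t : NTerm ar} {f : List (NTerm ar)}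
    {w : List A.Letter} :
    Compatible A (t :: f) w ↔ ∃ u v, w = u ++ v ∧ Compatible A [t] u ∧ Compatible A f v := by
  constructor
  · rintro ⟨a, rfl, h1, h2, h3⟩
    refine ⟨_, _, rfl, ⟨fun | .here x => a (.here x), ?_, ?_, ?_, ?_⟩,
      ⟨fun x => a (.there x), rfl, fun x hx => h1 (.there x) hx, fun x => h2 (.there x),
        fun j x y h => h3 j _ _ (.there h)⟩⟩
    · simp [preorderForest]
    · rintro (x | x) hx
      · exact h1 (.here x) hx
      · cases x
    · rintro (x | x)
      · exact h2 (.here x)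
      · cases x
    · rintro j _ _ (h | h)
      · exact h3 j _ _ (.here h)
      · cases h
  · rintro ⟨_, _, rfl, ⟨a, rfl, h1, h2, h3⟩, ⟨b, rfl, h1', h2', h3'⟩⟩
    refine ⟨fun | .here x => a (.here x) | .there x => b x, ?_, ?_, ?_, ?_⟩
    · simp [preorderForest]
    · rintro (x | x) hx
      · exact h1 (.here x) hx
      · exact h1' x hx
    · rintro (x | x)
      · exact h2 (.here x)
      · exact h2' x
    · rintro j _ _ (h | h)
      · exact h3 j _ _ (.here h)
      · exact h3' j _ _ h

theorem compatible_nil {A : ForestLikeAlphabet S} {w : List A.Letter} :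
    Compatible A ([] : List (NTerm ar)) w ↔ w = [] := by
  constructor
  · rintro ⟨a, rfl, -⟩
    rfl
  · rintro rfl
    refine ⟨(fun x => nomatch x), rfl, ?_, ?_, ?_⟩
    · intro x
      cases x
    · intro x
      cases x
    · intro _ x
      cases x

theorem compatible_append {A : ForestLikeAlphabet S} {f g : List (NTerm ar)} {w : List A.Letter} :
    Compatible A (f ++ g) w ↔ ∃ u v, w = u ++ v ∧ Compatible A f u ∧ Compatible A g v := by
  induction f generalizing w with
  | nil => simp [compatible_nil]
  | cons t f ih =>
    rw [List.cons_append, compatible_cons]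
    constructor
    · rintro ⟨u, v, rfl, h1, h2⟩
      obtain ⟨u', v', rfl, h3, h4⟩ := ih.1 h2
      exact ⟨u ++ u', v', by simp, compatible_cons.2 ⟨u, u', rfl, h1, h3⟩, h4⟩
    · rintro ⟨u, v, rfl, h1, h2⟩
      obtain ⟨u', v', rfl, h3, h4⟩ := compatible_cons.1 h1
      exact ⟨u', v' ++ v, by simp, h3, ih.2 ⟨v', v, rfl, h4, h2⟩⟩

theorem realize_E_mul (A : ForestLikeAlphabet S) (f : List (NTerm ar)) (w : List A.Letter)
    (x : NatFree ar K) : (realize ar K A (E K f * x)).1 w =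
      (realize ar K A (E K f)).1 (w.take (forestDeg f)) *
        (realize ar K A x).1 (w.drop (forestDeg f)) := by
  revert x
  refine word_induction (fun g => ?_) (fun a b ha hb => ?_) (fun c a ha => ?_)
  · rw [← E_append, realize_E, realize_E, realize_E, ite_mul, one_mul, zero_mul, ← ite_and]
    congr 1
    rw [compatible_append, eq_iff_iff]
    constructor
    · rintro ⟨u, v, rfl, h1, h2⟩
      rw [← h1.length]
      simpa using ⟨h1, h2⟩
    · rintro ⟨h1, h2⟩
      exact ⟨_, _, (List.take_append_drop _ _).symm, h1, h2⟩
  · simp only [mul_add, map_add, Submodule.coe_add, Pi.add_apply, ha, hb]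
  · simp only [mul_smul_comm, map_smul, Submodule.coe_smul, Pi.smul_apply, ha, smul_eq_mul]
    ring

theorem realize_mul_E (A : ForestLikeAlphabet S) (g : List (NTerm ar)) (w : List A.Letter)
    (x : NatFree ar K) : (realize ar K A (x * E K g)).1 w =
      (realize ar K A x).1 (w.take (w.length - forestDeg g)) *
        (realize ar K A (E K g)).1 (w.drop (w.length - forestDeg g)) := by
  revert x
  refine word_induction (fun f => ?_) (fun a b ha hb => ?_) (fun c a ha => ?_)
  · rw [← E_append, realize_E, realize_E, realize_E, ite_mul, one_mul, zero_mul, ← ite_and]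
    congr 1
    rw [compatible_append, eq_iff_iff]
    constructor
    · rintro ⟨u, v, rfl, h1, h2⟩
      rw [← h2.length, List.length_append, Nat.add_sub_cancel]
      simpa using ⟨h1, h2⟩
    · rintro ⟨h1, h2⟩
      exact ⟨_, _, (List.take_append_drop _ _).symm, h1, h2⟩
  · simp only [add_mul, map_add, Submodule.coe_add, Pi.add_apply, ha, hb]
  · simp only [smul_mul_assoc, map_smul, Submodule.coe_smul, Pi.smul_apply, ha, smul_eq_mul]
    ring

variable (ar) in
/-- The kernel of the realizing map, as an ideal. -/
noncomputable def kerRealize (A : ForestLikeAlphabet S) : Ideal (NatFree ar K) where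
  carrier := {x | realize ar K A x = 0}
  add_mem' {x y} hx hy := by
    change realize ar K A x = 0 at hx
    change realize ar K A y = 0 at hy
    change realize ar K A (x + y) = 0
    rw [map_add, hx, hy, add_zero]
  zero_mem' := map_zero (realize ar K A)
  smul_mem' c x hx := by
    change realize ar K A x = 0 at hx
    change realize ar K A (c * x) = 0
    revert c
    refine word_induction (fun f => ?_) (fun a b ha hb => ?_) (fun c a ha => ?_)
    · refine Subtype.ext (funext fun w => ?_)
      rw [realize_E_mul, hx]
      exact mul_zero _
    · rw [add_mul, map_add, ha, hb, add_zero]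
    · rw [smul_mul_assoc, map_smul, ha, smul_zero]

instance (A : ForestLikeAlphabet S) : (kerRealize ar K A).IsTwoSided where
  mul_mem_of_left {x} c hx := by
    change realize ar K A x = 0 at hx
    change realize ar K A (x * c) = 0
    revert c
    refine word_induction (fun f => ?_) (fun a b ha hb => ?_) (fun c a ha => ?_)
    · refine Subtype.ext (funext fun w => ?_)
      rw [realize_mul_E, hx]
      exact zero_mul _
    · rw [mul_add, map_add, ha, hb, add_zero]
    · rw [mul_smul_comm, map_smul, ha, smul_zero]

end Realization

end NaturalHopf

open NaturalHopf

/-!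
The edge relations of the alphabet of lengths do not depend on the index `j`, so the words
compatible with a reduced forest `f` depend only on `tr f`. Labelling each node of a trimmed forest
by its depth gives a compatible word that is minimal, letter by letter, among all compatible words,
and this word determines the trimmed forest. The images of distinct trimmed forests are therefore
triangular with respect to the total depth, hence linearly independent, and the kernel of the
realizing map is the kernel of the surjective bialgebra morphism `E_f ↦ E_{tr f}`. The theorem
is then the first isomorphism theorem, since bialgebra morphisms commute with antipodes.
-/

namespace NaturalHopf

section LinearAlgebra

theorem linearIndependent_of_triangular {R ι α : Type*} [Ring R] [NoZeroDivisors R]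
    (v : ι → α → R) (w : ι → α) (rank : ι → ℕ) (hdiag : ∀ i, v i (w i) ≠ 0)
    (htri : ∀ i j, v i (w j) ≠ 0 → i = j ∨ rank i < rank j) : LinearIndependent R v := by
  refine linearIndependent_iff.2 fun c hc => by_contra fun hne => ?_
  obtain ⟨j, hj, hmin⟩ :=
    Finset.exists_min_image c.support rank (Finsupp.support_nonempty_iff.2 hne)
  have hsum : ∑ i ∈ c.support, c i * v i (w j) = 0 := by
    simpa [Finsupp.linearCombination_apply, Finsupp.sum] using congrFun hc (w j)
  have hoff : ∀ i ∈ c.support, i ≠ j → c i * v i (w j) = 0 := fun i hi hij =>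
    mul_eq_zero_of_right _ <| by_contra fun h =>
      (htri i j h).elim hij fun hlt => (hmin i hi).not_gt hlt
  rw [Finset.sum_eq_single_of_mem j hj hoff] at hsum
  exact mul_ne_zero (Finsupp.mem_support_iff.1 hj) (hdiag j) hsum

theorem ker_eq_span_sub {R ι κ M N : Type*} [Ring R] [AddCommGroup M] [Module R M]
    [AddCommGroup N] [Module R N] (b : Module.Basis ι R M) (f : M →ₗ[R] N) (σ : ι → κ)
    {v : κ → N} (hv : LinearIndependent R v) (hf : ∀ i, f (b i) = v (σ i)) :
    LinearMap.ker f = Submodule.span R {x | ∃ i j, σ i = σ j ∧ x = b i - b j} := by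
  classical
  apply le_antisymm
  · intro x hx
    have hcollapse : (b.repr x).mapDomain σ = 0 := by
      refine linearIndependent_iff.1 hv _ ?_
      rw [Finsupp.linearCombination_mapDomain, show v ∘ σ = f ∘ b from funext fun i => (hf i).symm,
        ← Finsupp.apply_linearCombination, b.linearCombination_repr]
      exact hx
    set ρ : κ → M := Function.extend σ b 0 with hρ
    have hmem (i : ι) : b i - ρ (σ i) ∈
        Submodule.span R {x | ∃ i j, σ i = σ j ∧ x = b i - b j} := by
      have h : ∃ j, σ j = σ i := ⟨i, rfl⟩
      rw [hρ, Function.extend_def, dif_pos h]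
      exact Submodule.subset_span ⟨i, _, h.choose_spec.symm, rfl⟩
    have hx : x = Finsupp.linearCombination R (fun i => b i - ρ (σ i)) (b.repr x) := by
      have hzero : Finsupp.linearCombination R (ρ ∘ σ) (b.repr x) = 0 := by
        rw [← Finsupp.linearCombination_mapDomain, hcollapse, map_zero]
      calc x = Finsupp.linearCombination R b (b.repr x)
              - Finsupp.linearCombination R (ρ ∘ σ) (b.repr x) := by
            rw [hzero, sub_zero, b.linearCombination_repr]
        _ = _ := by
          simp only [Finsupp.linearCombination_apply, Finsupp.sum, Function.comp_apply, smul_sub,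
            Finset.sum_sub_distrib]
    rw [hx, Finsupp.linearCombination_apply]
    exact Submodule.sum_mem _ fun i _ => Submodule.smul_mem _ _ (hmem i)
  · refine Submodule.span_le.2 ?_
    rintro _ ⟨i, j, hij, rfl⟩
    rw [SetLike.mem_coe, LinearMap.mem_ker, map_sub, hf, hf, hij, sub_self]

end LinearAlgebra

section HopfAlgebra

open HopfAlgebra WithConv

-- Both sides are the convolution inverse of `f` among the linear maps from `A` to `B`.
theorem bialgHom_antipode {R A B : Type*} [CommSemiring R] [Semiring A] [Semiring B]
    [HopfAlgebra R A] [HopfAlgebra R B] (f : A →ₐc[R] B) (x : A) :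
    f (antipode R x) = antipode R (f x) := by
  let φ : A →ₗ[R] B := f.toCoalgHom.toLinearMap
  have hleft : toConv (antipode R ∘ₗ φ) * toConv φ = 1 := by
    apply ofConv_injective
    calc (toConv (antipode R ∘ₗ φ) * toConv φ).ofConv
        = (toConv (antipode R) * toConv .id : WithConv (B →ₗ[R] B)).ofConv ∘ₗ φ := by
          rw [LinearMap.convMul_comp_coalgHom_distrib]; rfl
      _ = _ := by rw [LinearMap.antipode_mul_id, LinearMap.convOne_comp_coalgHom]
  have hright : toConv φ * toConv (φ ∘ₗ antipode R) = 1 := by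
    apply ofConv_injective
    calc (toConv φ * toConv (φ ∘ₗ antipode R)).ofConv
        = (AlgHomClass.toAlgHom f).toLinearMap ∘ₗ
            (toConv .id * toConv (antipode R) : WithConv (A →ₗ[R] A)).ofConv := by
          rw [LinearMap.algHom_comp_convMul_distrib]; rfl
      _ = _ := by rw [LinearMap.id_mul_antipode, LinearMap.algHom_comp_convOne]
  exact congrArg (fun g : WithConv (A →ₗ[R] B) => g.ofConv x)
    (left_inv_eq_right_inv hleft hright).symm

variable {R : Type*} [CommRing R]

theorem isCoideal_ker {C D : Type*} [AddCommGroup C] [Module R C] [Coalgebra R C]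
    [AddCommGroup D] [Module R D] [Coalgebra R D] (f : C →ₗc[R] D)
    (hf : Function.Surjective f) : (LinearMap.ker f.toLinearMap).IsCoideal where
  counit_eq_zero x hx := by
    rw [← CoalgHomClass.counit_comp_apply f x, show f x = 0 from hx, map_zero]
  map_mkQ_comul_eq_zero x hx := by
    let e := f.toLinearMap.quotKerEquivOfSurjective hf
    have hmkQ : (LinearMap.ker f.toLinearMap).mkQ = e.symm.toLinearMap ∘ₗ f.toLinearMap :=
      LinearMap.ext fun y => e.eq_symm_apply.2 rfl
    rw [hmkQ, TensorProduct.map_comp, LinearMap.comp_apply,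
      show TensorProduct.map f.toLinearMap f.toLinearMap (Coalgebra.comul x) = _ from
        CoalgHomClass.map_comp_comul_apply f x, show f x = 0 from hx, map_zero, map_zero]

theorem isHopfIdeal_of_mem_iff {A B : Type*} [Ring A] [Ring B] [HopfAlgebra R A]
    [HopfAlgebra R B] (f : A →ₐc[R] B) (hf : Function.Surjective f) (I : Ideal A)
    (hI : ∀ x, x ∈ I ↔ f x = 0) : I.IsHopfIdeal R where
  toIsCoideal := by
    have hker : I.restrictScalars R = LinearMap.ker f.toCoalgHom.toLinearMap :=
      Submodule.ext hI
    exact hker ▸ isCoideal_ker f.toCoalgHom hf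
  antipode_mem x hx := by
    rw [hI, bialgHom_antipode, (hI x).1 hx, map_zero]

variable {A B : Type*} [Ring A] [Ring B] [Bialgebra R A] [Bialgebra R B] (f : A →ₐc[R] B)
    (I : Ideal A) [I.IsTwoSided] [(I.restrictScalars R).IsCoideal]

/-- The morphism of bialgebras on the quotient by a biideal `I` induced by a morphism of bialgebras
that vanishes on `I`. -/
noncomputable def quotientLift (hI : ∀ x ∈ I, f x = 0) : (A ⧸ I) →ₐc[R] B :=
  .ofAlgHom (Ideal.Quotient.liftₐ I (f : A →ₐ[R] B) hI)
    (Ideal.Quotient.algHom_ext R <| AlgHom.ext fun x => CoalgHomClass.counit_comp_apply f x)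
    (Ideal.Quotient.algHom_ext R <| AlgHom.ext fun x => by
      let q := (Ideal.Quotient.mkₐ R I).toLinearMap
      let l := (Ideal.Quotient.liftₐ I (f : A →ₐ[R] B) hI).toLinearMap
      change TensorProduct.map l l (TensorProduct.map q q (Coalgebra.comul x)) = _
      rw [← LinearMap.comp_apply, ← TensorProduct.map_comp]
      exact CoalgHomClass.map_comp_comul_apply f x)

/-- The first isomorphism theorem for bialgebras: a surjective morphism of bialgebras identifies its
codomain with the quotient by its kernel. -/
noncomputable def quotientEquivOfSurjective (hf : Function.Surjective f)
    (hI : ∀ x, x ∈ I ↔ f x = 0) : (A ⧸ I) ≃ₐc[R] B :=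
  .ofBijective (quotientLift f I fun x => (hI x).1)
    ⟨(injective_iff_map_eq_zero _).2 fun x hx => by
      obtain ⟨x, rfl⟩ := Ideal.Quotient.mk_surjective x
      exact Ideal.Quotient.eq_zero_iff_mem.2 ((hI x).2 hx),
    fun y => (hf y).imp' (Ideal.Quotient.mk I) fun _ => id⟩

end HopfAlgebra

section WordAlgebra
variable {X Y : Type*} {K : Type*} [Field K]

theorem quotient_linearMap_ext_word {M : Type*} [AddCommMonoid M] [Module K M]
    {I : Ideal (WordAlg K X)} [I.IsTwoSided] {g h : (WordAlg K X ⧸ I) →ₗ[K] M}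
    (H : ∀ f, g (Ideal.Quotient.mk I (E K f)) = h (Ideal.Quotient.mk I (E K f))) : g = h := by
  have hcomp : g ∘ₗ (Ideal.Quotient.mkₐ K I).toLinearMap =
      h ∘ₗ (Ideal.Quotient.mkₐ K I).toLinearMap :=
    (eBasis K X).ext fun f => by
      rw [eBasis_apply]
      exact H f
  exact (LinearMap.cancel_right (Ideal.Quotient.mkₐ_surjective K I)).1 hcomp

/-- The algebra morphism substituting the word `τ x` for each letter `x`. -/
noncomputable def substWord (τ : X → List Y) : WordAlg K X →ₐ[K] WordAlg K Y :=
  liftWord fun x => E K (τ x)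

theorem substWord_E (τ : X → List Y) (f : List X) :
    substWord τ (E K f) = E K (f.flatMap τ) := by
  rw [substWord, liftWord_E]
  induction f with
  | nil => exact E_nil.symm
  | cons x f ih => rw [List.map_cons, List.prod_cons, ih, ← E_append, List.flatMap_cons]

theorem map_substWord_sumE (τ : X → List Y) (m : Multiset (List X × List X)) :
    TensorProduct.map (substWord (K := K) τ).toLinearMap (substWord τ).toLinearMap (sumE m) =
      sumE (m.map (Prod.map (List.flatMap τ) (List.flatMap τ))) := by
  simp only [sumE, map_multiset_sum', Multiset.map_map, Function.comp_def, TensorProduct.map_tmul,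
    AlgHom.toLinearMap_apply, substWord_E, Prod.map_fst, Prod.map_snd]

theorem counitWord_comp_substWord (τ : X → List Y) (hτ : ∀ x, τ x ≠ []) :
    (counitWord K Y).comp (substWord τ) = counitWord K X :=
  algHom_ext_word fun x => by
    rw [AlgHom.comp_apply, substWord_E, counitWord_E, counitWord_E, List.flatMap_singleton,
      if_neg (hτ x), if_neg (List.cons_ne_nil x [])]

end WordAlgebra

section Trimming
variable {S : Type*} {ar : S → ℕ}

theorem tr_eq_flatMap (f : List (NTerm ar)) : tr f = f.flatMap fun t => t.1.tr.toList :=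
  List.filterMap_eq_flatMap_toList ..

theorem tr_append (f g : List (NTerm ar)) : tr (f ++ g) = tr f ++ tr g :=
  List.filterMap_append

theorem tr_rd_singleton (t : STerm ar) : tr (rd [t]) = t.tr.toList := by
  cases t with
  | leaf => rw [rd_leaf]; rfl
  | node s ts => rw [rd_node]; rfl

theorem toList_tr_ne_nil (t : NTerm ar) : t.1.tr.toList ≠ [] := by
  obtain ⟨_ | ⟨s, ts⟩, ht⟩ := t
  · exact absurd rfl ht
  · exact List.cons_ne_nil _ _

theorem cutSeq_map {T T' X X' : Type*} (F : T → T') (G : List X → List X') (hnil : G [] = [])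
    (happend : ∀ u v, G (u ++ v) = G u ++ G v) {n : ℕ} (m : Fin n → Multiset (T × List X)) :
    (cutSeq n m).map (Prod.map (F ∘ ·) G) = cutSeq n fun i => (m i).map (Prod.map F G) := by
  induction n with
  | zero =>
    simp only [cutSeq, Multiset.map_singleton, Prod.map_apply, hnil]
    rw [Subsingleton.elim (F ∘ Fin.elim0) Fin.elim0]
  | succ n ih =>
    have hcons (t : T) (ts : Fin n → T) :
        F ∘ (Fin.cons t ts : Fin (n + 1) → T) = Fin.cons (F t) (F ∘ ts) :=
      funext <| Fin.cases rfl fun _ => rfl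
    simp only [cutSeq, Multiset.map_bind, Multiset.bind_map, Multiset.map_map, ← ih]
    exact Multiset.bind_congr fun a _ => Multiset.map_congr rfl fun p _ =>
      Prod.ext (hcons a.1 p.1) (happend a.2 p.2)

theorem termCuts_map_tr (t : STerm ar) :
    (termCuts t).map (Prod.map STerm.tr tr) = TrimTree.optCuts t.tr := by
  induction t with
  | leaf => rw [termCuts_leaf]; rfl
  | node s ts ih =>
    rw [termCuts_node, STerm.tr, TrimTree.optCuts_node s le_rfl, Multiset.map_cons,
      Multiset.map_map]
    simp only [← ih]
    rw [← cutSeq_map STerm.tr tr rfl tr_append, Multiset.map_map]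
    rfl

theorem letterCuts_map_tr (t : NTerm ar) :
    ((termSystem ar).letterCuts t).map (Prod.map tr tr) =
      cutWord (TrimTree.trimSystem ar).letterCuts t.1.tr.toList := by
  have hcut : cutWord (TrimTree.trimSystem ar).letterCuts t.1.tr.toList =
      (TrimTree.optCuts t.1.tr).map (Prod.map Option.toList id) :=
    (TrimTree.trimSystem ar).cutWord_toWord t.1.tr
  rw [hcut, ← termCuts_map_tr, CutSystem.letterCuts, Multiset.map_map, Multiset.map_map]
  exact Multiset.map_congr rfl fun p _ => Prod.ext (tr_rd_singleton p.1) rfl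

variable (ar) in
/-- The morphism of bialgebras sending `E_f` to `E_{tr f}`. -/
noncomputable def trimHom (K : Type*) [Field K] : NatFree ar K →ₐc[K] NCK ar K :=
  .ofAlgHom (substWord fun t => t.1.tr.toList)
    (counitWord_comp_substWord _ toList_tr_ne_nil)
    (algHom_ext_word fun t => by
      have hτ : List.flatMap (fun t : NTerm ar => t.1.tr.toList) = tr :=
        funext fun f => (tr_eq_flatMap f).symm
      change TensorProduct.map _ _ (natCoprod ar K (E K [t])) =
        nckCoprod ar K (substWord _ (E K [t]))
      rw [natCoprod_E, substWord_E, nckCoprod_E, cutWord_singleton, List.flatMap_singleton,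
        ← letterCuts_map_tr, ← hτ]
      exact map_substWord_sumE _ _)

variable {K : Type*} [Field K]

theorem trimHom_E (f : List (NTerm ar)) : trimHom ar K (E K f) = E K (tr f) := by
  rw [tr_eq_flatMap]
  exact substWord_E _ f

theorem reduceOption_ofFn_dite {X : Type*} {k n : ℕ} (hk : k ≤ n) (ts : Fin k → X) :
    (List.ofFn fun i : Fin n => if h : (i : ℕ) < k then some (ts ⟨i, h⟩) else none).reduceOption =
      List.ofFn ts := by
  obtain ⟨d, rfl⟩ := Nat.exists_eq_add_of_le hk
  have hnone : (List.replicate d (none : Option X)).reduceOption = [] := by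
    simp [List.reduceOption]
  simp [List.ofFn_add, List.reduceOption_append, hnone, TrimTree.reduceOption_ofFn_some]

/-- The term with the given trimmed tree whose leaves are the rightmost children of each node. -/
def TrimTree.addLeaves : TrimTree ar → STerm ar
  | node s k _ ts => .node s fun i => if h : (i : ℕ) < k then (ts ⟨i, h⟩).addLeaves else .leaf

theorem TrimTree.tr_addLeaves (t : TrimTree ar) : t.addLeaves.tr = some t := by
  induction t with
  | node s k hk ts ih =>
    have hchildren (i : Fin (ar s)) :
        (if h : (i : ℕ) < k then (ts ⟨i, h⟩).addLeaves else .leaf).tr =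
          if h : (i : ℕ) < k then some (ts ⟨i, h⟩) else none := by
      split_ifs
      exacts [ih _, rfl]
    rw [addLeaves, STerm.tr, Option.some_inj]
    refine graftRoot_ofFn _ _ _ _ _ _ ?_
    simp only [hchildren, reduceOption_ofFn_dite hk]

theorem tr_surjective : Function.Surjective (tr : List (NTerm ar) → List (TrimTree ar)) := by
  intro f
  refine ⟨f.map fun t => ⟨t.addLeaves, fun h => ?_⟩, ?_⟩
  · simpa [h, STerm.tr] using t.tr_addLeaves
  · simp [tr, List.filterMap_map, TrimTree.tr_addLeaves]

theorem trimHom_surjective : Function.Surjective (trimHom ar K) := by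
  refine word_induction (fun g => ?_) ?_ ?_
  · obtain ⟨f, rfl⟩ := tr_surjective g
    exact ⟨E K f, trimHom_E f⟩
  · rintro _ _ ⟨x, rfl⟩ ⟨y, rfl⟩
    exact ⟨x + y, map_add _ x y⟩
  · rintro c _ ⟨x, rfl⟩
    exact ⟨c • x, map_smul _ c x⟩

end Trimming

section CompatibleWords
variable {S : Type*} {ar : S → ℕ} (A : ForestLikeAlphabet S) (R : Set A.Letter)

theorem mem_prod_ofFn {α : Type*} {n : ℕ} (L : Fin n → Language α) (v : List α) :
    v ∈ (List.ofFn L).prod ↔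
      ∃ ws : Fin n → List α, (∀ i, ws i ∈ L i) ∧ (List.ofFn ws).flatten = v := by
  induction n generalizing v with
  | zero => simp [Language.mem_one, eq_comm]
  | succ n ih =>
    simp only [List.ofFn_succ, List.prod_cons, Language.mem_mul, ih, Fin.exists_fin_succ_pi,
      Fin.forall_fin_succ, Fin.cons_zero, Fin.cons_succ, List.flatten_cons]
    constructor
    · rintro ⟨u, hu, _, ⟨ws, hws, rfl⟩, rfl⟩
      exact ⟨u, ws, ⟨hu, hws⟩, rfl⟩
    · rintro ⟨u, ws, ⟨hu, hws⟩, rfl⟩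
      exact ⟨u, hu, _, ⟨ws, hws, rfl⟩, rfl⟩

/-- The words of letters on the internal nodes of a term, in left to right preorder, that satisfy
the decoration and edge relations and whose root letter, if any, is in `R`. -/
def STerm.words (t : STerm ar) : Language A.Letter :=
  {w | ∃ a : t.Node → A.Letter, t.preorder a = w ∧ (∀ x, x.IsRoot → a x ∈ R) ∧
    (∀ x, a x ∈ A.deco x.deco) ∧ ∀ j x y, STerm.Edge j t x y → A.edge j (a x) (a y)}

theorem STerm.words_leaf : (leaf : STerm ar).words A R = 1 :=
  Set.ext fun _ => ⟨fun ⟨_, h, _⟩ => h.symm,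
    fun h => ⟨nofun, Eq.symm h, nofun, nofun, nofun⟩⟩

theorem STerm.mem_words_node {s : S} {ts : Fin (ar s) → STerm ar} {w : List A.Letter} :
    w ∈ (node s ts).words A R ↔ ∃ x ∈ R ∩ A.deco s,
      ∃ v ∈ (List.ofFn fun i => (ts i).words A {y | A.edge (i : ℕ).succPNat x y}).prod,
        w = x :: v := by
  simp only [mem_prod_ofFn]
  constructor
  · rintro ⟨a, rfl, hroot, hdeco, hedge⟩
    refine ⟨a (.root s ts), ⟨hroot _ trivial, hdeco (.root s ts)⟩, _, ⟨_, fun i => ?_, rfl⟩, rfl⟩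
    exact ⟨fun x => a (.child s ts i x), rfl, fun x hx => hedge _ _ _ (.root s ts i rfl x hx),
      fun x => hdeco (.child s ts i x), fun j x y h => hedge j _ _ (.child _ _ _ _ _ h)⟩
  · rintro ⟨x, ⟨hxR, hxs⟩, _, ⟨ws, hws, rfl⟩, rfl⟩
    choose b hb hroot hdeco hedge using hws
    refine ⟨fun | .root _ _ => x | .child _ _ i y => b i y, ?_, ?_, ?_, ?_⟩
    · simp only [preorder, hb]
    · rintro (_ | ⟨_, _, i, y⟩) hy
      exacts [hxR, hy.elim]
    · rintro (_ | ⟨_, _, i, y⟩)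
      exacts [hxs, hdeco i y]
    · rintro j _ _ (⟨_, _, i, hi, y, hy⟩ | ⟨_, _, i, y, z, h⟩)
      · obtain rfl : j = (i : ℕ).succPNat := PNat.eq hi
        exact hroot i y hy
      · exact hedge i j y z h

theorem compatible_singleton {t : NTerm ar} {w : List A.Letter} :
    Compatible A [t] w ↔ w ∈ t.1.words A A.root := by
  constructor
  · rintro ⟨a, rfl, hroot, hdeco, hedge⟩
    exact ⟨fun x => a (.here x), (List.append_nil _).symm, fun x => hroot (.here x),
      fun x => hdeco (.here x), fun j x y h => hedge j _ _ (.here h)⟩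
  · rintro ⟨a, rfl, hroot, hdeco, hedge⟩
    refine ⟨fun | .here x => a x, List.append_nil _, ?_, ?_, ?_⟩
    · rintro (x | x) hx
      exacts [hroot x hx, nomatch x]
    · rintro (x | x)
      exacts [hdeco x, nomatch x]
    · rintro j _ _ (h | h)
      exacts [hedge j _ _ h, nomatch h]

theorem compatible_iff {f : List (NTerm ar)} {w : List A.Letter} :
    Compatible A f w ↔ w ∈ (f.map fun t => t.1.words A A.root).prod := by
  induction f generalizing w with
  | nil => exact compatible_nil
  | cons t f ih =>
    rw [compatible_cons, List.map_cons, List.prod_cons, Language.mem_mul]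
    simp only [compatible_singleton, ih]
    constructor
    · rintro ⟨u, v, rfl, hu, hv⟩
      exact ⟨u, hu, v, hv, rfl⟩
    · rintro ⟨u, hu, v, hv, rfl⟩
      exact ⟨u, v, rfl, hu, hv⟩

/-- The words of letters on the nodes of a trimmed tree, in left to right preorder, that satisfy
the decoration relations, have their root letter in `R`, and in which the letters of a node and
of any of its children form a `1`-edge. -/
def TrimTree.words (R : Set A.Letter) : TrimTree ar → Language A.Letter
  | node s _ _ ts => {w | ∃ x ∈ R ∩ A.deco s,
      ∃ v ∈ (List.ofFn fun i => (ts i).words {y | A.edge 1 x y}).prod, w = x :: v}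

/-- The concatenations of words of the successive trees of a trimmed forest, in the sense of
`TrimTree.words`. -/
def forestWords (f : List (TrimTree ar)) : Language A.Letter := (f.map (TrimTree.words A R)).prod

theorem forestWords_flatMap {X : Type*} (g : X → List (TrimTree ar)) (l : List X) :
    forestWords A R (l.flatMap g) = (l.map fun x => forestWords A R (g x)).prod := by
  rw [forestWords, List.map_flatMap, List.flatMap, List.prod_flatten, List.map_map]
  rfl

theorem TrimTree.mem_words_graftRoot {s : S} {f : List (TrimTree ar)} {hf : f.length ≤ ar s}
    {w : List A.Letter} : w ∈ (graftRoot s f hf).words A R ↔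
      ∃ x ∈ R ∩ A.deco s, ∃ v ∈ forestWords A {y | A.edge 1 x y} f, w = x :: v := by
  simp only [forestWords, ← List.ofFn_getElem_eq_map]
  rfl

variable {A}

theorem STerm.words_eq_forestWords (hA : ∀ j x y, A.edge j x y ↔ A.edge 1 x y) (t : STerm ar) :
    t.words A R = forestWords A R t.tr.toList := by
  induction t generalizing R with
  | leaf => exact words_leaf A R
  | node s ts ih =>
    ext w
    have hchildren (x : A.Letter) :
        (List.ofFn fun i => (ts i).words A {y | A.edge (i : ℕ).succPNat x y}).prod =
          forestWords A {y | A.edge 1 x y} (List.ofFn fun i => (ts i).tr).reduceOption := by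
      simp only [hA, ih]
      rw [List.reduceOption, List.filterMap_eq_flatMap_toList, forestWords_flatMap, List.map_ofFn]
      rfl
    have hroot : forestWords A R (node s ts).tr.toList =
        (TrimTree.graftRoot s _ (TrimTree.reduceOption_ofFn_length le_rfl _)).words A R :=
      List.prod_singleton
    simp only [mem_words_node, hroot, TrimTree.mem_words_graftRoot, hchildren]

theorem compatible_iff_mem_forestWords (hA : ∀ j x y, A.edge j x y ↔ A.edge 1 x y)
    {f : List (NTerm ar)} {w : List A.Letter} :
    Compatible A f w ↔ w ∈ forestWords A A.root (tr f) := by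
  rw [compatible_iff, tr_eq_flatMap, forestWords_flatMap]
  simp only [STerm.words_eq_forestWords _ hA]

end CompatibleWords

section Lengths
variable {S : Type*} {ar : S → ℕ}
open ForestLikeAlphabet

/-- The letters of the alphabet of lengths, as pairs of a decoration and a length. -/
def lengthsEquiv : (lengths S).Letter ≃ S × ℕ :=
  Setoid.quotientKerEquivOfRightInverse (fun a : S × List ℕ => (a.1, a.2.length))
    (fun p => (p.1, List.replicate p.2 0)) fun _ => Prod.ext rfl List.length_replicate

theorem mem_deco_lengths {s : S} {x : (lengths S).Letter} :
    x ∈ (lengths S).deco s ↔ (lengthsEquiv x).1 = s := by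
  constructor
  · rintro ⟨a, rfl, rfl⟩
    rfl
  · rintro rfl
    exact ⟨_, rfl, lengthsEquiv.symm_apply_apply x⟩

theorem edge_lengths {j : ℕ+} {x y : (lengths S).Letter} :
    (lengths S).edge j x y ↔ (lengthsEquiv x).2 < (lengthsEquiv y).2 := by
  constructor
  · rintro ⟨a, b, ⟨l, h⟩, rfl, rfl⟩
    change a.2.length < b.2.length
    simp [h]
  · intro h
    obtain ⟨l, hl⟩ := Nat.exists_eq_add_of_lt h
    refine ⟨((lengthsEquiv x).1, List.replicate (lengthsEquiv x).2 0),
      ((lengthsEquiv y).1, List.replicate (lengthsEquiv x).2 0 ++ [(j : ℕ)] ++ List.replicate l 0),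
      ⟨l, rfl⟩, lengthsEquiv.symm_apply_apply x, lengthsEquiv.injective (Prod.ext rfl ?_)⟩
    change List.length _ = _
    simp only [List.length_append, List.length_replicate, List.length_singleton, hl]
    omega

/-- The letters of length at least `m`. -/
def atLeast (m : ℕ) : Set (lengths S).Letter := {x | m ≤ (lengthsEquiv x).2}

theorem root_lengths : (lengths S).root = atLeast 0 :=
  Set.ext fun x => ⟨fun _ => Nat.zero_le _,
    fun _ => ⟨_, ⟨_, rfl⟩, lengthsEquiv.symm_apply_apply x⟩⟩

theorem setOf_edge_lengths {j : ℕ+} (x : (lengths S).Letter) :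
    {y | (lengths S).edge j x y} = atLeast ((lengthsEquiv x).2 + 1) :=
  Set.ext fun _ => edge_lengths

theorem compatible_lengths_iff {f : List (NTerm ar)} {w : List (lengths S).Letter} :
    Compatible (lengths S) f w ↔ w ∈ forestWords (lengths S) (atLeast 0) (tr f) := by
  rw [compatible_iff_mem_forestWords fun j x y => edge_lengths.trans edge_lengths.symm,
    root_lengths]

end Lengths

section Depths
variable {S : Type*} {ar : S → ℕ}
open ForestLikeAlphabet

theorem forest_induction {P : List (TrimTree ar) → Prop} (nil : P [])
    (cons : ∀ s f hf g, P f → P g → P (TrimTree.graftRoot s f hf :: g)) (f : List (TrimTree ar)) :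
    P f := by
  have cons_of_tree (t : TrimTree ar) : ∀ g, P g → P (t :: g) := by
    induction t with
    | node s k hk ts ih =>
      intro g hg
      have hchildren : ∀ l ⊆ List.ofFn ts, P l := by
        intro l hl
        induction l with
        | nil => exact nil
        | cons t l ihl =>
          obtain ⟨i, rfl⟩ := List.mem_ofFn.1 (hl List.mem_cons_self)
          exact ih i l (ihl (List.subset_of_cons_subset hl))
      rw [← TrimTree.graftRoot_ofFn s k hk ts _ (by simpa using hk) rfl]
      exact cons s _ _ g (hchildren _ (List.Subset.refl _)) hg
  induction f with
  | nil => exact nil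
  | cons t f ih => exact cons_of_tree t f ih

theorem mem_forestWords_graftRoot_cons {A : ForestLikeAlphabet S} {R : Set A.Letter} {s : S}
    {f g : List (TrimTree ar)} {hf : f.length ≤ ar s} {w : List A.Letter} :
    w ∈ forestWords A R (TrimTree.graftRoot s f hf :: g) ↔ ∃ x ∈ R ∩ A.deco s,
      ∃ u ∈ forestWords A {y | A.edge 1 x y} f, ∃ v ∈ forestWords A R g, w = x :: (u ++ v) := by
  rw [forestWords, List.map_cons, List.prod_cons, Language.mem_mul]
  simp only [TrimTree.mem_words_graftRoot]
  constructor
  · rintro ⟨_, ⟨x, hx, u, hu, rfl⟩, v, hv, rfl⟩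
    exact ⟨x, hx, u, hu, v, hv, rfl⟩
  · rintro ⟨x, hx, u, hu, v, hv, rfl⟩
    exact ⟨x :: u, ⟨x, hx, u, hu, rfl⟩, v, hv, rfl⟩

/-- The decorations and depths of the nodes of a trimmed tree whose root is given depth `m`, in
left to right preorder. -/
def TrimTree.depths : TrimTree ar → ℕ → List (S × ℕ)
  | node s _ _ ts, m => (s, m) :: (List.ofFn fun i => (ts i).depths (m + 1)).flatten

/-- The decorations and depths of the nodes of a trimmed forest whose roots are given depth `m`, in
left to right preorder. -/
def forestDepths (m : ℕ) (f : List (TrimTree ar)) : List (S × ℕ) := f.flatMap (·.depths m)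

theorem forestDepths_graftRoot_cons (m : ℕ) (s : S) (f : List (TrimTree ar)) (hf : f.length ≤ ar s)
    (g : List (TrimTree ar)) : forestDepths m (TrimTree.graftRoot s f hf :: g) =
      (s, m) :: (forestDepths (m + 1) f ++ forestDepths m g) := by
  have hf' : f.flatMap (·.depths (m + 1)) = (List.ofFn fun i => (f.get i).depths (m + 1)).flatten :=
    congrArg List.flatten (List.ofFn_getElem_eq_map ..).symm
  rw [forestDepths, List.flatMap_cons, forestDepths, hf']
  rfl

theorem le_of_mem_forestDepths (f : List (TrimTree ar)) :
    ∀ m, ∀ p ∈ forestDepths m f, m ≤ p.2 := by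
  induction f using forest_induction with
  | nil => simp [forestDepths]
  | cons s f hf g ihf ihg =>
    intro m p hp
    rw [forestDepths_graftRoot_cons, List.mem_cons, List.mem_append] at hp
    obtain rfl | hp | hp := hp
    exacts [le_rfl, (ihf (m + 1) p hp).trans' m.le_succ, ihg m p hp]

theorem takeWhile_forestDepths (m : ℕ) (f g : List (TrimTree ar)) :
    (forestDepths (m + 1) f ++ forestDepths m g).takeWhile (m < ·.2) = forestDepths (m + 1) f := by
  have hg : (forestDepths m g).takeWhile (m < ·.2) = [] := by
    induction g using forest_induction with
    | nil => rfl
    | cons s f hf g => simp [forestDepths_graftRoot_cons]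
  have hf : ∀ p ∈ forestDepths (m + 1) f, decide (m < p.2) :=
    fun p hp => decide_eq_true (le_of_mem_forestDepths f _ p hp)
  rw [List.takeWhile_append_of_pos hf, hg, List.append_nil]

theorem forestDepths_injective (m : ℕ) :
    Function.Injective (forestDepths m : List (TrimTree ar) → List (S × ℕ)) := by
  intro f
  induction f using forest_induction generalizing m with
  | nil =>
    intro g h
    induction g using forest_induction with
    | nil => rfl
    | cons s g hg g' => cases h.trans (forestDepths_graftRoot_cons ..)
  | cons s f hf f' ihf ihf' =>
    intro g h
    induction g using forest_induction with
    | nil => cases h.symm.trans (forestDepths_graftRoot_cons ..)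
    | cons s' g hg g' =>
      rw [forestDepths_graftRoot_cons, forestDepths_graftRoot_cons, List.cons.injEq] at h
      obtain ⟨hroot, hrest⟩ := h
      have hdeep : forestDepths (m + 1) f = forestDepths (m + 1) g := by
        rw [← takeWhile_forestDepths m f f', hrest, takeWhile_forestDepths]
      rw [hdeep, List.append_cancel_left_eq] at hrest
      obtain rfl := congrArg Prod.fst hroot
      obtain rfl := ihf _ hdeep
      rw [ihf' _ hrest]

theorem map_forestDepths_mem_forestWords (f : List (TrimTree ar)) : ∀ m,
    (forestDepths m f).map lengthsEquiv.symm ∈ forestWords (lengths S) (atLeast m) f := by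
  induction f using forest_induction with
  | nil => exact fun m => rfl
  | cons s f hf g ihf ihg =>
    intro m
    rw [forestDepths_graftRoot_cons, List.map_cons, List.map_append, mem_forestWords_graftRoot_cons]
    refine ⟨lengthsEquiv.symm (s, m), ⟨?_, ?_⟩, _, ?_, _, ihg m, rfl⟩
    · simp [atLeast]
    · simp [mem_deco_lengths]
    · simpa [setOf_edge_lengths] using ihf (m + 1)

theorem forall₂_forestDepths {f : List (TrimTree ar)} {m n : ℕ} (hmn : m ≤ n)
    {w : List (lengths S).Letter} (hw : w ∈ forestWords (lengths S) (atLeast n) f) :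
    (forestDepths m f).Forall₂ (fun p q => p.1 = q.1 ∧ p.2 ≤ q.2) (w.map lengthsEquiv) := by
  induction f using forest_induction generalizing m n w with
  | nil => obtain rfl := hw; exact .nil
  | cons s f hf g ihf ihg =>
    obtain ⟨x, ⟨hxn, hxs⟩, u, hu, v, hv, rfl⟩ := mem_forestWords_graftRoot_cons.1 hw
    rw [setOf_edge_lengths] at hu
    rw [forestDepths_graftRoot_cons, List.map_cons, List.map_append]
    have hmx : m ≤ (lengthsEquiv x).2 := hmn.trans hxn
    exact .cons ⟨(mem_deco_lengths.1 hxs).symm, hmx⟩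
      (List.rel_append (ihf (Nat.succ_le_succ hmx) hu) (ihg hmn hv))

theorem eq_or_sum_lt_of_forall₂ {u v : List (S × ℕ)}
    (h : u.Forall₂ (fun p q => p.1 = q.1 ∧ p.2 ≤ q.2) v) :
    u = v ∨ (u.map Prod.snd).sum < (v.map Prod.snd).sum := by
  induction h with
  | nil => exact .inl rfl
  | @cons p q u v hpq _ ih =>
    obtain ⟨a, i⟩ := p
    obtain ⟨b, j⟩ := q
    obtain ⟨rfl : a = b, hij : i ≤ j⟩ := hpq
    obtain rfl | hij := hij.eq_or_lt
    · refine ih.imp (congrArg _) fun h => ?_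
      simpa using h
    · have hle : (u.map Prod.snd).sum ≤ (v.map Prod.snd).sum :=
        ih.elim (fun h => h ▸ le_rfl) le_of_lt
      exact .inr (by simpa using add_lt_add_of_lt_of_le hij hle)

end Depths

section Kernel
variable {S : Type*} (ar : S → ℕ)
open ForestLikeAlphabet

theorem linearIndependent_forestWords_indicator (R : Type*) [Ring R] [IsDomain R] (m : ℕ) :
    LinearIndependent R fun f : List (TrimTree ar) =>
      (forestWords (lengths S) (atLeast m) f).indicator (1 : List (lengths S).Letter → R) := by
  refine linearIndependent_of_triangular _
    (fun f => (forestDepths m f).map lengthsEquiv.symm)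
    (fun f => ((forestDepths m f).map Prod.snd).sum) (fun f => ?_) fun f g h => ?_
  · rw [Set.indicator_of_mem (map_forestDepths_mem_forestWords f m)]
    exact one_ne_zero
  · have hle := forall₂_forestDepths le_rfl (Set.mem_of_indicator_ne_zero h)
    rw [List.map_map, Equiv.self_comp_symm, List.map_id] at hle
    exact (eq_or_sum_lt_of_forall₂ hle).imp_left (@forestDepths_injective S ar m f g)

variable (K : Type*) [Field K]

theorem ker_realize_lengths : LinearMap.ker (realize ar K (lengths S)) =
    Submodule.span K {x | ∃ f g : List (NTerm ar), tr f = tr g ∧ x = E K f - E K g} := by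
  classical
  rw [← LinearMap.ker_comp_of_ker_eq_bot _ (Submodule.ker_subtype _)]
  simp only [← eBasis_apply]
  refine ker_eq_span_sub _ _ tr (linearIndependent_forestWords_indicator ar K 0) fun f => ?_
  rw [eBasis_apply]
  refine funext fun w => (realize_E K (lengths S) f w).trans ?_
  simp only [compatible_lengths_iff]
  rfl

theorem ker_trimHom : LinearMap.ker (trimHom ar K : NatFree ar K →ₗ[K] NCK ar K) =
    Submodule.span K {x | ∃ f g : List (NTerm ar), tr f = tr g ∧ x = E K f - E K g} := by
  simp only [← eBasis_apply]
  exact ker_eq_span_sub _ _ tr (eBasis K (TrimTree ar)).linearIndependent fun f => by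
    rw [eBasis_apply, eBasis_apply]
    exact trimHom_E f

theorem mem_kerRealize_lengths (x : NatFree ar K) :
    x ∈ kerRealize ar K (lengths S) ↔ trimHom ar K x = 0 :=
  SetLike.ext_iff.1 ((ker_realize_lengths ar K).trans (ker_trimHom ar K).symm) x

end Kernel

end NaturalHopf

theorem mainTheorem5_general (K : Type*) [Field K] (S : Type*) (ar : S → ℕ) :
    LinearMap.ker (realize ar K (ForestLikeAlphabet.lengths S)) =
        Submodule.span K {x | ∃ f₁ f₂ : List (NTerm ar), tr f₁ = tr f₂ ∧ x = E K f₁ - E K f₂} ∧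
      ∃ _ : (kerRealize ar K (ForestLikeAlphabet.lengths S)).IsHopfIdeal K,
        ∃ φ : (NatFree ar K ⧸ kerRealize ar K (ForestLikeAlphabet.lengths S)) ≃ₐc[K] NCK ar K,
          (∀ f : List (NTerm ar), φ (Ideal.Quotient.mk _ (E K f)) = E K (tr f)) ∧
          (∀ x, φ (HopfAlgebra.antipode K x) = HopfAlgebra.antipode K (φ x)) ∧
          ∀ ψ : (NatFree ar K ⧸ kerRealize ar K (ForestLikeAlphabet.lengths S)) →ₗ[K] NCK ar K,
            (∀ f : List (NTerm ar), ψ (Ideal.Quotient.mk _ (E K f)) = E K (tr f)) →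
              ∀ x, ψ x = φ x := by
  have hker := mem_kerRealize_lengths ar K
  have hHopf : (kerRealize ar K (ForestLikeAlphabet.lengths S)).IsHopfIdeal K :=
    isHopfIdeal_of_mem_iff (trimHom ar K) trimHom_surjective _ hker
  let φ := quotientEquivOfSurjective (trimHom ar K) _ trimHom_surjective hker
  have hφ (f : List (NTerm ar)) : φ (Ideal.Quotient.mk _ (E K f)) = E K (tr f) := trimHom_E f
  refine ⟨ker_realize_lengths ar K, hHopf, φ, hφ, fun x => ?_, fun ψ hψ x => ?_⟩
  · exact bialgHom_antipode (φ : _ →ₐc[K] NCK ar K) x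
  · exact LinearMap.congr_fun (quotient_linearMap_ext_word (h := (φ : _ →ₗ[K] NCK ar K))
      fun f => (hψ f).trans (hφ f).symm) x

theorem mainTheorem5 (K : Type*) [Field K] [CharZero K] (S : Type*) (ar : S → ℕ) :
    LinearMap.ker (realize ar K (ForestLikeAlphabet.lengths S)) =
        Submodule.span K {x | ∃ f₁ f₂ : List (NTerm ar), tr f₁ = tr f₂ ∧ x = E K f₁ - E K f₂} ∧
      ∃ _ : (kerRealize ar K (ForestLikeAlphabet.lengths S)).IsHopfIdeal K,
        ∃ φ : (NatFree ar K ⧸ kerRealize ar K (ForestLikeAlphabet.lengths S)) ≃ₐc[K] NCK ar K,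
          (∀ f : List (NTerm ar), φ (Ideal.Quotient.mk _ (E K f)) = E K (tr f)) ∧
          (∀ x, φ (HopfAlgebra.antipode K x) = HopfAlgebra.antipode K (φ x)) ∧
          ∀ ψ : (NatFree ar K ⧸ kerRealize ar K (ForestLikeAlphabet.lengths S)) →ₗ[K] NCK ar K,
            (∀ f : List (NTerm ar), ψ (Ideal.Quotient.mk _ (E K f)) = E K (tr f)) →
              ∀ x, ψ x = φ x :=
  mainTheorem5_general K S ar
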